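/- **Setting.** Let $K,n$ be natural numbers and $\mathscr S=\{1,\dots,K\}$. For each $k\in\mathscr S$ let $A_k\in\mathbb R^{n\times n}$ be negative definite (that is, $x^{\top}A_kx<0$ for all $x\ne 0$; $A_k$ need not be symmetric), $b_k\in\mathbb R^n$, and let $f_k$ be a probability distribution on $\mathbb R^n$ with zero mean and finite second moment. Let $P=[p_{i,j}]$ be a stochastic $K\times K$ matrix. On a probability space let $(s_t)_{t\ge 0}$ be a Markov chain on $\mathscr S$ with transition matrix $P$ and arbitrary initial distribution, and let $(w_t)_{t\ge1}$ be random vectors in $\mathbb R^n$ which, conditionally on the state sequence, are independent with $w_t\sim f_{s_t}$. The input $x_t\in\mathbb R^n$ at stage $t\ge 1$ is chosen after $s_{t-1}$ and before $s_t$ is observed, and the output is $y_t=A_{s_t}x_t+b_{s_t}+w_t$. The stage cost is $\mathbb E(-x_t^{\top}y_t\mid s_{t-1},x_t)$; given $s_{t-1}=i$, its unique minimizer is the optimal input $$x_i^*=-\Big(\sum_j p_{i,j}(A_j+A_j^{\top})\Big)^{-1}\sum_j p_{i,j}b_j .$$ Let $\Pi\subset\mathbb R^n$ be a convex compact set with $x_i^*\in\Pi$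 for all $i\in\mathscr S$, and let $(\cdot)_\Pi$ be the Euclidean projection onto $\Pi$. **The MSPSA policy.** For each $i\in\mathscr S$ fix reals $\gamma_i,\gamma_i'>0$, integers $N_i,N_i'\ge0$ and an initial estimate $\hat x_{i,1}\in\Pi$; put $a_{i,k}=\gamma_i/(N_i+k)$ and $c_{i,k}=\gamma_i'/(N_i'+k)^{1/4}$ for $k\ge1$. Let $\nu$ be a probability distribution on $\mathbb R$, symmetric around $0$, such that a random variable $Z\sim\nu$ satisfies $|Z|\le\xi_1$ almost surely and $\mathbb E(1/Z^2)\le\xi_2$ for some constants $\xi_1,\xi_2$ (in particular $Z\neq0$ almost surely). Let $(\Delta^{(t)})_{t\ge1}$ be random vectors in $\mathbb R^n$ whose entries, over all $t$, are independent with distribution $\nu$, the whole family being independent of $((s_t)_{t\ge0},(w_t)_{t\ge1})$. Start with $t_i=0$ and $e_i=0$ for every $i$. At stage $t=1,2,\dots$, with $i=s_{t-1}$: * if $e_i=0$: replace $t_i$ by $t_i+1$, set $\Delta_{i,t_i}=\Delta^{(t)}$, use the input $x_t=\hat x_{i,t_i}+c_{i,t_i}\Delta_{i,t_i}$, put $d^+_{i,t_i}=-x_t^{\top}y_t$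 and set $e_i=1$; * if $e_i=1$: use the input $x_t=\hat x_{i,t_i}-c_{i,t_i}\Delta_{i,t_i}$, put $d^-_{i,t_i}=-x_t^{\top}y_t$, set $e_i=0$, and update $$\hat x_{i,t_i+1}=\Big(\hat x_{i,t_i}-a_{i,t_i}\frac{d^+_{i,t_i}-d^-_{i,t_i}}{c_{i,t_i}}\bar\Delta_{i,t_i}\Big)_{\Pi},$$ where $\bar\Delta_{i,k}$ is the vector of the reciprocals of the entries of $\Delta_{i,k}$. **Theorem.** The input $x_T$ of the MSPSA policy for revenue maximization converges to the optimal input $x^*_{s_{T-1}}$ almost surely and in mean square: $$\Pr\Big(\lim_{T\to\infty}\|x_T-x^*_{s_{T-1}}\|_2^2=0\Big)=1,$$ and $\mathbb E\big(\|x_T-x^*_{s_{T-1}}\|_2^2\big)<\infty$ for every $T\ge1$ with $$\lim_{T\to\infty}\mathbb E\big(\|x_T-x^*_{s_{T-1}}\|_2^2\big)=0 .$$ -/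

import Mathlib

open MeasureTheory ProbabilityTheory Filter Topology
open scoped RealInnerProductSpace

noncomputable section

namespace MarkovJump

/-- The Euclidean space of inputs and outputs. -/
abbrev Vec (n : ℕ) : Type := EuclideanSpace ℝ (Fin n)

/-- Negative definiteness of a real square matrix that need not be symmetric. -/
def NegDef {n : ℕ} (A : Matrix (Fin n) (Fin n) ℝ) : Prop :=
  ∀ x : Vec n, x ≠ 0 → ⟪x, Matrix.toEuclideanLin A x⟫ < 0

/-- The parameters of a Markov jump affine model with `K` states and equal input and output
dimension `n`: the affine maps `x ↦ A k x + b k`, the transition matrix and the noise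
distributions. -/
structure Model (K n : ℕ) where
  A : Fin K → Matrix (Fin n) (Fin n) ℝ
  b : Fin K → Vec n
  P : Matrix (Fin K) (Fin K) ℝ
  f : Fin K → Measure (Vec n)

/-- The standing assumptions on the parameters: negative definite system matrices, a stochastic
transition matrix, and noise distributions with zero mean and finite variance. -/
structure Model.IsAdmissible {K n : ℕ} (M : Model K n) : Prop where
  negDef : ∀ k, NegDef (M.A k)
  stochastic : M.P ∈ Matrix.rowStochastic ℝ (Fin K)
  isProb : ∀ k, IsProbabilityMeasure (M.f k)
  memLp : ∀ k, MemLp (fun w : Vec n => w) 2 (M.f k)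
  mean_zero : ∀ k, ∫ w, w ∂(M.f k) = 0

/-- The output of the system in state `k` for the input `x` and the noise `w`. -/
def Model.output {K n : ℕ} (M : Model K n) (k : Fin K) (x w : Vec n) : Vec n :=
  Matrix.toEuclideanLin (M.A k) x + M.b k + w

/-- The stage cost of revenue maximization: the expectation of `- x ⬝ y` for the input `x`, given
that the previous state is `i`. -/
def Model.stageCost {K n : ℕ} (M : Model K n) (i : Fin K) (x : Vec n) : ℝ :=
  ∑ j, M.P i j * ∫ w, -⟪x, M.output j x w⟫ ∂(M.f j)

/-- The optimal input after the state `i` under known model. -/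
def Model.optimalInput {K n : ℕ} (M : Model K n) (i : Fin K) : Vec n :=
  -Matrix.toEuclideanLin (∑ j, M.P i j • (M.A j + (M.A j).transpose))⁻¹ (∑ j, M.P i j • M.b j)

/-- The processes `s` (states) and `w` (noise) on `(Ω, μ)` follow the model. Here `s t` is the
state at time `t`, while `w t` is the noise of stage `t + 1`, which produces the output at time
`t + 1`. The last field says that `s` is a Markov chain with transition matrix `P` (and arbitrary
initial distribution), and that, given the states, the noise vectors are independent and the noise
of stage `t + 1` is distributed according to `f (s (t + 1))`. -/
structure Model.IsRealizedBy {K n : ℕ} (M : Model K n) {Ω : Type*} [MeasurableSpace Ω]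
    (μ : Measure Ω) (s : ℕ → Ω → Fin K) (w : ℕ → Ω → Vec n) : Prop where
  measurable_state : ∀ t, Measurable (s t)
  measurable_noise : ∀ t, Measurable (w t)
  law : ∀ (T : ℕ) (σ : ℕ → Fin K) (B : ℕ → Set (Vec n)), (∀ t, MeasurableSet (B t)) →
    μ {ω | (∀ t ≤ T, s t ω = σ t) ∧ ∀ t < T, w t ω ∈ B t} =
      μ {ω | s 0 ω = σ 0} *
        ∏ t ∈ Finset.range T,
          (ENNReal.ofReal (M.P (σ t) (σ (t + 1))) * M.f (σ (t + 1)) (B t))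

/-- Admissible distributions for the entries of the perturbation vectors: symmetric around zero,
bounded by `ξ₁`, and with `𝔼 (1 / Δ²) ≤ ξ₂`. The last expectation is taken in `[0, ∞]`, where
`1 / 0 = ∞`, so that it forces `Δ ≠ 0` almost surely. -/
structure IsPerturbationLaw (ν : Measure ℝ) (ξ₁ ξ₂ : ℝ) : Prop where
  isProb : IsProbabilityMeasure ν
  symm : ν.map (fun z => -z) = ν
  bounded : ∀ᵐ z ∂ν, |z| ≤ ξ₁
  inv_sq : ∫⁻ z, (ENNReal.ofReal (z ^ 2))⁻¹ ∂ν ≤ ENNReal.ofReal ξ₂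

/-- The perturbation vectors `D t` (the fresh vector that is available to the policy at stage
`t + 1`): all entries, over all stages, are independent with law `ν`, and the whole family is
independent of the states and the noise. -/
structure IsPerturbation {K n : ℕ} {Ω : Type*} [MeasurableSpace Ω] (μ : Measure Ω) (ν : Measure ℝ)
    (s : ℕ → Ω → Fin K) (w D : ℕ → Ω → Vec n) : Prop where
  measurable : ∀ t, Measurable (D t)
  law : ∀ t j, μ.map (fun ω => D t ω j) = ν
  indep_entries : iIndepFun (fun (p : ℕ × Fin n) (ω : Ω) => D p.1 ω p.2) μ
  indep_model : IndepFun (fun ω t => D t ω) (fun ω => (fun t => s t ω, fun t => w t ω)) μ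

/-- Euclidean projection onto a set `S`: a point of `S` nearest to `x` (for nonempty compact convex
`S` it exists and is unique). -/
def proj {n : ℕ} (S : Set (Vec n)) (x : Vec n) : Vec n :=
  open Classical in
  if h : ∃ y ∈ S, ∀ z ∈ S, ‖x - y‖ ≤ ‖x - z‖ then h.choose else x

/-- The tuning parameters of the MSPSA policy: the feasible set `Π`, the initial estimates
`x̂_{i,1}`, and the constants of the step sizes and of the perturbation gains. -/
structure Params (K n : ℕ) where
  feasible : Set (Vec n)
  init : Fin K → Vec n
  γ : Fin K → ℝ
  γ' : Fin K → ℝ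
  N : Fin K → ℕ
  N' : Fin K → ℕ

/-- The requirements of the policy on its tuning parameters. -/
structure Params.IsAdmissible {K n : ℕ} (p : Params K n) : Prop where
  convex : Convex ℝ p.feasible
  compact : IsCompact p.feasible
  init_mem : ∀ i, p.init i ∈ p.feasible
  γ_pos : ∀ i, 0 < p.γ i
  γ'_pos : ∀ i, 0 < p.γ' i

/-- The step size `a_k = γ_i / (N_i + k)` of state `i`. -/
def Params.a {K n : ℕ} (p : Params K n) (i : Fin K) (k : ℕ) : ℝ :=
  p.γ i / ((p.N i : ℝ) + k)

/-- The perturbation gain `c_k = γ'_i / (N'_i + k) ^ (1/4)` of state `i`. -/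
def Params.c {K n : ℕ} (p : Params K n) (i : Fin K) (k : ℕ) : ℝ :=
  p.γ' i / ((p.N' i : ℝ) + k) ^ (1 / 4 : ℝ)

/-- The memory of the MSPSA policy; every entry is indexed by the state `i` of the chain:
the current estimate, the counter `t_i`, the flag `e_i` (`true` stands for `e_i = 1`), the last
perturbation vector `Δ_{t_i}` and the last observed cost `d⁺_{i,t_i}`. -/
structure Memory (K n : ℕ) where
  est : Fin K → Vec n
  count : Fin K → ℕ
  flag : Fin K → Bool
  pert : Fin K → Vec n
  dplus : Fin K → ℝ

/-- The initial memory: `t_i = 0` and `e_i = 0` for all `i`. The entries `pert` and `dplus` are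
overwritten before they are used. -/
def Params.start {K n : ℕ} (p : Params K n) : Memory K n where
  est := p.init
  count := fun _ => 0
  flag := fun _ => false
  pert := fun _ => 0
  dplus := fun _ => 0

/-- The input chosen by MSPSA after observing the state `i`, where `Δ` is a fresh perturbation
vector (used only if `e_i = 0`). -/
def Params.input {K n : ℕ} (p : Params K n) (m : Memory K n) (i : Fin K) (Δ : Vec n) : Vec n :=
  if m.flag i = false then m.est i + p.c i (m.count i + 1) • Δ
  else m.est i - p.c i (m.count i) • m.pert i

/-- The memory of MSPSA for revenue maximization after a stage at which the state `i` was observed,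
the fresh perturbation vector was `Δ`, and the output `y` resulted. -/
def Params.update {K n : ℕ} (p : Params K n) (m : Memory K n) (i : Fin K) (Δ y : Vec n) :
    Memory K n :=
  let d : ℝ := -⟪p.input m i Δ, y⟫
  if m.flag i = false then
    { m with
      count := Function.update m.count i (m.count i + 1)
      flag := Function.update m.flag i true
      pert := Function.update m.pert i Δ
      dplus := Function.update m.dplus i d }
  else
    { m with
      est := Function.update m.est i
        (proj p.feasible
          (m.est i - (p.a i (m.count i) * ((m.dplus i - d) / p.c i (m.count i))) •
            WithLp.toLp 2 (fun j => 1 / m.pert i j)))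
      flag := Function.update m.flag i false }

/-- The memory of MSPSA after `t` stages, when it is run on the system `M` along the state path `s`,
the noise path `w` and the perturbations `D`. -/
def Params.run {K n : ℕ} (p : Params K n) (M : Model K n) (s : ℕ → Fin K) (w D : ℕ → Vec n) :
    ℕ → Memory K n
  | 0 => p.start
  | t + 1 =>
    let m := p.run M s w D t
    p.update m (s t) (D t) (M.output (s (t + 1)) (p.input m (s t) (D t)) (w t))

/-- The input `x_T` of MSPSA at the stage `T = t + 1`, which is chosen after observing the state
`s_{T-1} = s t`. -/
def Params.inputAt {K n : ℕ} (p : Params K n) (M : Model K n) (s : ℕ → Fin K) (w D : ℕ → Vec n)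
    (t : ℕ) : Vec n :=
  p.input (p.run M s w D t) (s t) (D t)

/-- `proj` is a nearest-point map on nonempty compact sets. -/
theorem proj_spec {n : ℕ} {S : Set (Vec n)} (hS : IsCompact S) (hne : S.Nonempty) (x : Vec n) :
    proj S x ∈ S ∧ ∀ z ∈ S, ‖x - proj S x‖ ≤ ‖x - z‖ := by
  have h : ∃ y ∈ S, ∀ z ∈ S, ‖x - y‖ ≤ ‖x - z‖ := by
    obtain ⟨y, hy, hmin⟩ := hS.exists_isMinOn hne
      (f := fun y => ‖x - y‖) (by fun_prop)
    exact ⟨y, hy, fun z hz => hmin hz⟩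
  unfold proj
  rw [dif_pos h]
  exact h.choose_spec

theorem Model.stageCost_eq {K n : ℕ} {M : Model K n} (hM : M.IsAdmissible) (i : Fin K) (x : Vec n) :
    M.stageCost i x =
      -⟪x, Matrix.toEuclideanLin (∑ j, M.P i j • M.A j) x⟫ - ⟪x, ∑ j, M.P i j • M.b j⟫ := by
  have h1 : ∀ j, ∫ w, -⟪x, M.output j x w⟫ ∂(M.f j) =
      -⟪x, Matrix.toEuclideanLin (M.A j) x⟫ - ⟪x, M.b j⟫ := by
    intro j
    have := hM.isProb j
    have hi : Integrable (fun w : Vec n => w) (M.f j) := (hM.memLp j).integrable (by norm_num)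
    have h2 : ∫ w, ⟪x, w⟫ ∂(M.f j) = 0 := by
      rw [integral_inner hi, hM.mean_zero j, inner_zero_right]
    simp only [Model.output, inner_add_right]
    rw [integral_neg, integral_add (integrable_const _) (hi.const_inner x), h2]
    simp
    ring
  unfold Model.stageCost
  simp only [h1, map_sum, map_smul, LinearMap.sum_apply, LinearMap.smul_apply, inner_sum,
    inner_smul_right]
  rw [← Finset.sum_neg_distrib, ← Finset.sum_sub_distrib]
  exact Finset.sum_congr rfl fun j _ => by ring

theorem inner_transpose {n : ℕ} (A : Matrix (Fin n) (Fin n) ℝ) (x y : Vec n) :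
    ⟪x, Matrix.toEuclideanLin A.transpose y⟫ = ⟪Matrix.toEuclideanLin A x, y⟫ := by
  rw [← LinearMap.adjoint_inner_right, ← Matrix.toEuclideanLin_conjTranspose_eq_adjoint,
    Matrix.conjTranspose_eq_transpose_of_trivial]

/-- `optimalInput` is the unique minimizer of the stage cost. -/
theorem Model.stageCost_optimalInput_lt {K n : ℕ} {M : Model K n} (hM : M.IsAdmissible) (i : Fin K)
    (x : Vec n) (hx : x ≠ M.optimalInput i) :
    M.stageCost i (M.optimalInput i) < M.stageCost i x := by
  set Q : Matrix (Fin n) (Fin n) ℝ := ∑ j, M.P i j • M.A j with hQ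
  set β : Vec n := ∑ j, M.P i j • M.b j with hβ
  have hH : (∑ j, M.P i j • (M.A j + (M.A j).transpose)) = Q + Q.transpose := by
    simp [hQ, smul_add, Finset.sum_add_distrib, Matrix.transpose_sum]
  have hP := Matrix.mem_rowStochastic_iff_sum.1 hM.stochastic
  have hneg : ∀ v : Vec n, v ≠ 0 → ⟪v, Matrix.toEuclideanLin Q v⟫ < 0 := by
    intro v hv
    have e : ⟪v, Matrix.toEuclideanLin Q v⟫
        = ∑ j, M.P i j * ⟪v, Matrix.toEuclideanLin (M.A j) v⟫ := by
      simp only [hQ, map_sum, map_smul, LinearMap.sum_apply, LinearMap.smul_apply, inner_sum,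
        inner_smul_right]
    rw [e]
    have hex : ∃ j, 0 < M.P i j := by
      by_contra hcon
      push Not at hcon
      have : ∑ j, M.P i j ≤ 0 := Finset.sum_nonpos fun j _ => hcon j
      have h1 := hP.2 i
      linarith
    obtain ⟨j, hj⟩ := hex
    refine Finset.sum_neg' (fun k _ => ?_) ⟨j, Finset.mem_univ j, ?_⟩
    · exact mul_nonpos_of_nonneg_of_nonpos (hP.1 i k) (hM.negDef k v hv).le
    · exact mul_neg_of_pos_of_neg hj (hM.negDef j v hv)
  have hdet : IsUnit (Q + Q.transpose).det := by
    rw [← Matrix.isUnit_iff_isUnit_det, ← Matrix.mulVec_injective_iff_isUnit]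
    intro u v huv
    by_contra hne
    have hne' : WithLp.toLp 2 (u - v) ≠ (0 : Vec n) := by
      intro h0
      apply hne
      have : u - v = 0 := by simpa using congrArg WithLp.ofLp h0
      exact sub_eq_zero.1 this
    have h0 : Matrix.toEuclideanLin (Q + Q.transpose) (WithLp.toLp 2 (u - v)) = 0 := by
      rw [Matrix.toLpLin_apply]
      simp only [Matrix.mulVec_sub]
      rw [huv, sub_self, WithLp.toLp_zero]
    have h1 := hneg _ hne'
    have h2 : ⟪WithLp.toLp 2 (u - v),
        Matrix.toEuclideanLin (Q + Q.transpose) (WithLp.toLp 2 (u - v))⟫ = (0 : ℝ) := by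
      rw [h0, inner_zero_right]
    rw [map_add, LinearMap.add_apply, inner_add_right, inner_transpose, real_inner_comm] at h2
    rw [real_inner_comm] at h1
    linarith
  have hfoc : Matrix.toEuclideanLin (Q + Q.transpose) (M.optimalInput i) = -β := by
    unfold Model.optimalInput
    rw [hH, map_neg, Matrix.toLpLin_apply, Matrix.toLpLin_apply]
    simp [Matrix.mulVec_mulVec, Matrix.mul_nonsing_inv _ hdet, hβ]
  set xs := M.optimalInput i with hxs
  have hd := hneg (x - xs) (sub_ne_zero.2 hx)
  have hf : ⟪x - xs, Matrix.toEuclideanLin (Q + Q.transpose) xs⟫ = -⟪x - xs, β⟫ := by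
    rw [hfoc, inner_neg_right]
  rw [map_add, LinearMap.add_apply, inner_add_right, inner_transpose] at hf
  rw [Model.stageCost_eq hM, Model.stageCost_eq hM, ← hQ, ← hβ]
  simp only [map_sub, inner_sub_left, inner_sub_right] at hd hf
  have c1 := real_inner_comm xs (Matrix.toEuclideanLin Q x)
  have c2 := real_inner_comm xs (Matrix.toEuclideanLin Q xs)
  linarith

end MarkovJump

end

namespace MarkovJump

/-! ### Euclidean projection onto a compact convex set. -/

section Projection

variable {n : ℕ} {S : Set (Vec n)}

/-! Each state `i` runs its own stochastic approximation, touched only at stages where `i` was just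
observed (`Params.slot_run_succ`), so the states are treated separately. Write `o` for the optimal
input after `i`.

The expected cost is a quadratic with minimizer `o` and coercive quadratic part, so its symmetric
differences are exactly linear in the direction (`Model.stageCost_add_sub_stageCost_sub`): the
finite difference has no bias, whatever the gain `c`. Since `recip d` and `d` have the identity as
mean outer product (`IsPerturbationLaw.vecLaw_inner_mul`), a pair of measurements yields a multiple
of an unbiased gradient estimate, with second moment of order `1 / c ^ 2`. Projection does not
increase the distance from `o`. Hence one pair turns the squared error `v` into at most `v - 8 * l *
a * v + C * (a / c) ^ 2` in the mean (`lintegral_step_le`).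

The sum of `(a / c) ^ 2` converges, so adding its tail to `v` gives a nonnegative function that
decreases in the mean. The two measurements of a pair can lie far apart, with other states in
between; inside a pair the function is therefore defined as the mean of the value after the second
measurement. It is then a supermartingale in the stage index (`Params.exists_lyap_step`), because
perturbation, next state and noise have a law that depends on the past only through the current
state (`setLIntegral_fresh`). So it converges almost surely and its mean decreases `8 * l * a * v`
are summable (`ae_tendsto_of_setLIntegral_succ_le`). As the steps `a` sum to infinity, a state
visited infinitely often must have limit zero (`tendsto_of_lyapunov`); a state visited finitely
often has no influence on the limit, so no recurrence is needed.

Inputs differ from estimates by at most a bounded multiple of `c`, which tends to zero. They are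
uniformly bounded almost surely, so mean square convergence follows by dominated convergence. -/

theorem proj_mem (hS : IsCompact S) (hne : S.Nonempty) (x : Vec n) : proj S x ∈ S :=
  (proj_spec hS hne x).1

/-- Variational characterization of the nearest point; convexity of the set enters only here. -/
theorem inner_sub_proj_nonpos (hc : Convex ℝ S) (hS : IsCompact S) (hne : S.Nonempty)
    (x : Vec n) {z : Vec n} (hz : z ∈ S) : ⟪x - proj S x, z - proj S x⟫ ≤ 0 := by
  obtain ⟨h1, h2⟩ := proj_spec hS hne x
  refine (norm_eq_iInf_iff_real_inner_le_zero hc h1).1 (le_antisymm ?_ ?_) z hz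
  · have : Nonempty S := ⟨⟨_, h1⟩⟩
    exact le_ciInf fun w => h2 w w.2
  · exact ciInf_le (f := fun w : S => ‖x - w‖) ⟨0, by rintro _ ⟨w, rfl⟩; positivity⟩ ⟨_, h1⟩

theorem norm_proj_sub_proj_le (hc : Convex ℝ S) (hS : IsCompact S) (hne : S.Nonempty)
    (x y : Vec n) : ‖proj S x - proj S y‖ ≤ ‖x - y‖ := by
  have h1 := inner_sub_proj_nonpos hc hS hne x (proj_mem hS hne y)
  have h2 := inner_sub_proj_nonpos hc hS hne y (proj_mem hS hne x)
  have h3 : ‖proj S x - proj S y‖ ^ 2 ≤ ⟪x - y, proj S x - proj S y⟫ := by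
    rw [← real_inner_self_eq_norm_sq]
    simp only [inner_sub_left, inner_sub_right] at *
    linarith
  have h4 := real_inner_le_norm (x - y) (proj S x - proj S y)
  rcases (norm_nonneg (proj S x - proj S y)).eq_or_lt with h | h
  · rw [← h]; positivity
  · nlinarith

theorem proj_eq_self (hS : IsCompact S) {x : Vec n} (hx : x ∈ S) : proj S x = x := by
  have := (proj_spec hS ⟨x, hx⟩ x).2 x hx
  rw [sub_self, norm_zero, norm_le_zero_iff, sub_eq_zero] at this
  exact this.symm

theorem norm_proj_sub_le (hc : Convex ℝ S) (hS : IsCompact S) {z : Vec n} (hz : z ∈ S)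
    (x : Vec n) : ‖proj S x - z‖ ≤ ‖x - z‖ := by
  simpa only [proj_eq_self hS hz] using norm_proj_sub_proj_le hc hS ⟨z, hz⟩ x z

theorem continuous_proj (hc : Convex ℝ S) (hS : IsCompact S) (hne : S.Nonempty) :
    Continuous (proj S) :=
  (LipschitzWith.of_dist_le_mul (K := 1) fun x y => by
    simpa [dist_eq_norm] using norm_proj_sub_proj_le hc hS hne x y).continuous

end Projection

/-! ### The quadratic stage cost, and moments of the observed cost. -/

section Cost

variable {K n : ℕ} {M : Model K n}

/-- The quadratic part of the stage cost after the state `i`. -/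
noncomputable def Model.quad (M : Model K n) (i : Fin K) : Vec n →ₗ[ℝ] Vec n :=
  -Matrix.toEuclideanLin (∑ j, M.P i j • M.A j)

/-- Along each line through the optimal input the cost is a quadratic polynomial, and minimality
kills its linear coefficient. Only the minimizing property is used, not the formula with the inverse
matrix. -/
theorem Model.stageCost_eq_add_quad (hM : M.IsAdmissible) (i : Fin K) (x : Vec n) :
    M.stageCost i x = M.stageCost i (M.optimalInput i) +
      ⟪x - M.optimalInput i, M.quad i (x - M.optimalInput i)⟫ := by
  set o := M.optimalInput i
  set y := x - o
  set T := M.quad i with hT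
  set β : Vec n := ∑ j, M.P i j • M.b j
  have key : ∀ z, M.stageCost i z = ⟪z, T z⟫ - ⟪z, β⟫ := fun z => by
    rw [Model.stageCost_eq hM, hT, Model.quad, LinearMap.neg_apply, inner_neg_right]
  have hmin : ∀ z, M.stageCost i o ≤ M.stageCost i z := fun z => by
    rcases eq_or_ne z o with rfl | h
    · exact le_rfl
    · exact (Model.stageCost_optimalInput_lt hM i z h).le
  set l : ℝ := ⟪y, T o⟫ + ⟪o, T y⟫ - ⟪y, β⟫ with hl
  have hexp : ∀ t : ℝ, M.stageCost i (o + t • y)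
      = M.stageCost i o + t * l + t ^ 2 * ⟪y, T y⟫ := fun t => by
    rw [key, key, hl]
    simp only [map_add, map_smul, inner_add_left, inner_add_right, inner_smul_left,
      inner_smul_right, RCLike.conj_to_real]
    ring
  have hl0 : l = 0 := by
    have h : ∀ t : ℝ, 0 ≤ t * l + t ^ 2 * ⟪y, T y⟫ := fun t => by
      have := hmin (o + t • y)
      rw [hexp] at this
      linarith
    by_contra hne
    have hq : 0 ≤ |⟪y, T y⟫| := abs_nonneg _
    -- A step against the slope `l`, short enough for the linear term to beat the quadratic one; the
    -- `+ 1` avoids division by zero.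
    have h1 := h (-l / (|⟪y, T y⟫| + 1))
    have h2 : (-l / (|⟪y, T y⟫| + 1)) * l + (-l / (|⟪y, T y⟫| + 1)) ^ 2 * ⟪y, T y⟫
        = l ^ 2 / (|⟪y, T y⟫| + 1) ^ 2 * (⟪y, T y⟫ - |⟪y, T y⟫| - 1) := by
      field_simp
      ring
    rw [h2] at h1
    have h3 : 0 < l ^ 2 / (|⟪y, T y⟫| + 1) ^ 2 := by positivity
    nlinarith [le_abs_self ⟪y, T y⟫]
  have := hexp 1
  rw [one_smul, hl0] at this
  have e : o + y = x := by simp [y]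
  rw [e] at this
  linarith

theorem Model.inner_quad_pos (hM : M.IsAdmissible) (i : Fin K) {y : Vec n} (hy : y ≠ 0) :
    0 < ⟪y, M.quad i y⟫ := by
  have h := Model.stageCost_eq_add_quad hM i (M.optimalInput i + y)
  have h2 := Model.stageCost_optimalInput_lt hM i (M.optimalInput i + y) (by simpa using hy)
  rw [add_sub_cancel_left] at h
  linarith

/-- The positive minimum over the unit sphere, extended by homogeneity. In dimension zero the sphere
is empty and any constant serves. -/
theorem Model.exists_quad_coercive (hM : M.IsAdmissible) (i : Fin K) :
    ∃ c > 0, ∀ y, c * ‖y‖ ^ 2 ≤ ⟪y, M.quad i y⟫ := by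
  rcases (Metric.sphere (0 : Vec n) 1).eq_empty_or_nonempty with he | hne
  · refine ⟨1, one_pos, fun y => ?_⟩
    rcases eq_or_ne y 0 with rfl | hy
    · simp
    · have : ‖y‖⁻¹ • y ∈ Metric.sphere (0 : Vec n) 1 := by
        simp [norm_smul, hy]
      simp [he] at this
  · have hcont : Continuous fun y : Vec n => ⟪y, M.quad i y⟫ :=
      continuous_id.inner (M.quad i).continuous_of_finiteDimensional
    obtain ⟨z, hz, hmin⟩ := (isCompact_sphere (0 : Vec n) 1).exists_isMinOn hne hcont.continuousOn
    have hz0 : z ≠ 0 := by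
      rintro rfl
      simp at hz
    refine ⟨_, Model.inner_quad_pos hM i hz0, fun y => ?_⟩
    rcases eq_or_ne y 0 with rfl | hy
    · simp
    · have hmem : ‖y‖⁻¹ • y ∈ Metric.sphere (0 : Vec n) 1 := by
        simp [norm_smul, hy]
      have h := hmin hmem
      simp only [Set.mem_ofPred_eq, map_smul, inner_smul_left, inner_smul_right,
        RCLike.conj_to_real] at h
      have hy' : 0 < ‖y‖ := norm_pos_iff.2 hy
      calc _ ≤ (‖y‖⁻¹ * (‖y‖⁻¹ * ⟪y, M.quad i y⟫)) * ‖y‖ ^ 2 := by gcongr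
        _ = _ := by field_simp

/-- Symmetric differences of the stage cost are linear in the direction. -/
theorem Model.stageCost_add_sub_stageCost_sub (hM : M.IsAdmissible) (i : Fin K) (x v : Vec n)
    (c : ℝ) :
    M.stageCost i (x + c • v) - M.stageCost i (x - c • v) =
      2 * c * ⟪M.quad i (x - M.optimalInput i)
        + LinearMap.adjoint (M.quad i) (x - M.optimalInput i), v⟫ := by
  rw [Model.stageCost_eq_add_quad hM i (x + c • v), Model.stageCost_eq_add_quad hM i (x - c • v),
    inner_add_left, LinearMap.adjoint_inner_left, add_sub_right_comm, sub_right_comm]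
  simp only [map_add, map_sub, map_smul, inner_add_left, inner_add_right, inner_sub_left,
    inner_sub_right, inner_smul_left, inner_smul_right, RCLike.conj_to_real]
  rw [real_inner_comm v, real_inner_comm v]
  ring

/-- The joint law of the next state and the next noise after the state `i`. -/
noncomputable def Model.nextLaw (M : Model K n) (i : Fin K) : Measure (Fin K × Vec n) :=
  ∑ j, ENNReal.ofReal (M.P i j) • (M.f j).map (Prod.mk j)

theorem Model.isProbabilityMeasure_nextLaw (hM : M.IsAdmissible) (i : Fin K) :
    IsProbabilityMeasure (M.nextLaw i) := by
  have hP := Matrix.mem_rowStochastic_iff_sum.1 hM.stochastic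
  constructor
  simp only [Model.nextLaw, Measure.coe_finsetSum, Finset.sum_apply, Measure.smul_apply,
    smul_eq_mul]
  have : ∀ j, (M.f j).map (Prod.mk j) Set.univ = 1 := fun j => by
    have := hM.isProb j
    rw [Measure.map_apply measurable_prodMk_left MeasurableSet.univ]
    simp
  simp only [this, mul_one]
  rw [← ENNReal.ofReal_sum_of_nonneg fun j _ => hP.1 i j, hP.2 i, ENNReal.ofReal_one]

theorem Model.nextLaw_singleton_prod (M : Model K n) (i j : Fin K) {B : Set (Vec n)}
    (hB : MeasurableSet B) :
    M.nextLaw i ({j} ×ˢ B) = ENNReal.ofReal (M.P i j) * M.f j B := by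
  simp only [Model.nextLaw, Measure.coe_finsetSum, Finset.sum_apply, Measure.smul_apply,
    smul_eq_mul]
  rw [Finset.sum_eq_single j]
  · rw [Measure.map_apply measurable_prodMk_left ((measurableSet_singleton j).prod hB)]
    congr 2
    ext; simp
  · intro k _ hk
    rw [Measure.map_apply measurable_prodMk_left ((measurableSet_singleton j).prod hB)]
    have : Prod.mk k ⁻¹' ({j} ×ˢ B) = ∅ := by ext; simp [hk]
    rw [this]; simp
  · simp

theorem Model.integrable_nextLaw (i : Fin K) {g : Fin K × Vec n → ℝ} (hg : Measurable g)
    (h : ∀ j, Integrable (fun w => g (j, w)) (M.f j)) : Integrable g (M.nextLaw i) := by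
  refine integrable_finsetSum_measure.2 fun j _ => Integrable.smul_measure ?_ (by simp)
  exact (integrable_map_measure hg.aestronglyMeasurable measurable_prodMk_left.aemeasurable).2 (h j)

theorem Model.integral_nextLaw (hM : M.IsAdmissible) (i : Fin K) {g : Fin K × Vec n → ℝ}
    (hg : Measurable g) (h : ∀ j, Integrable (fun w => g (j, w)) (M.f j)) :
    ∫ z, g z ∂M.nextLaw i = ∑ j, M.P i j * ∫ w, g (j, w) ∂M.f j := by
  have hP := Matrix.mem_rowStochastic_iff_sum.1 hM.stochastic
  unfold Model.nextLaw
  rw [integral_finsetSum_measure]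
  · refine Finset.sum_congr rfl fun j _ => ?_
    rw [integral_smul_measure, integral_map measurable_prodMk_left.aemeasurable
      hg.aestronglyMeasurable, ENNReal.toReal_ofReal (hP.1 i j), smul_eq_mul]
  · intro j _
    refine Integrable.smul_measure ?_ (by simp)
    exact (integrable_map_measure hg.aestronglyMeasurable
      measurable_prodMk_left.aemeasurable).2 (h j)

/-- The observed cost of the input `x` when `z` is the pair of the next state and the noise. -/
noncomputable def Model.cost (M : Model K n) (x : Vec n) (z : Fin K × Vec n) : ℝ :=
  -⟪x, M.output z.1 x z.2⟫

theorem Model.measurable_output (M : Model K n) :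
    Measurable fun q : Fin K × Vec n × Vec n => M.output q.1 q.2.1 q.2.2 := by
  refine measurable_from_prod_countable_right fun j => ?_
  have h := (Matrix.toEuclideanLin (M.A j)).continuous_of_finiteDimensional
  have : Continuous fun q : Vec n × Vec n => M.output j q.1 q.2 := by
    unfold Model.output
    fun_prop
  exact this.measurable

theorem Model.measurable_cost (M : Model K n) :
    Measurable fun q : Vec n × Fin K × Vec n => M.cost q.1 q.2 := by
  have h := M.measurable_output.comp (f := fun q : Vec n × Fin K × Vec n => (q.2.1, q.1, q.2.2))
    (by fun_prop)
  exact (measurable_fst.inner h).neg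

theorem Model.measurable_cost_right (M : Model K n) (x : Vec n) : Measurable (M.cost x) :=
  M.measurable_cost.comp (g := fun q : Vec n × Fin K × Vec n => M.cost q.1 q.2)
    (f := fun z => (x, z)) measurable_prodMk_left

/-- The constant is uniform over a ball of inputs and over the finitely many states, so the variance
bound will not depend on the iterate. -/
theorem Model.exists_sq_cost_le (M : Model K n) (ρ : ℝ) :
    ∃ C, 0 ≤ C ∧ ∀ x : Vec n, ‖x‖ ≤ ρ → ∀ z, M.cost x z ^ 2 ≤ C * (1 + ‖z.2‖ ^ 2) := by
  set α : ℝ := ∑ j, ‖LinearMap.toContinuousLinearMap (Matrix.toEuclideanLin (M.A j))‖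
  set β : ℝ := ∑ j, ‖M.b j‖
  have hα : 0 ≤ α := Finset.sum_nonneg fun _ _ => norm_nonneg _
  have hβ : 0 ≤ β := Finset.sum_nonneg fun _ _ => norm_nonneg _
  refine ⟨2 * ρ ^ 2 * ((α * ρ + β) ^ 2 + 1), by positivity, fun x hx z => ?_⟩
  obtain ⟨j, w⟩ := z
  have hρ : 0 ≤ ρ := (norm_nonneg x).trans hx
  have h1 : ‖Matrix.toEuclideanLin (M.A j) x‖ ≤ α * ρ := by
    refine ((LinearMap.toContinuousLinearMap (Matrix.toEuclideanLin (M.A j))).le_opNorm x).trans ?_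
    gcongr
    exact Finset.single_le_sum
      (f := fun j => ‖LinearMap.toContinuousLinearMap (Matrix.toEuclideanLin (M.A j))‖)
      (fun _ _ => norm_nonneg _) (Finset.mem_univ j)
  have h2 : ‖M.b j‖ ≤ β :=
    Finset.single_le_sum (f := fun j => ‖M.b j‖) (fun _ _ => norm_nonneg _) (Finset.mem_univ j)
  have h3 : |M.cost x (j, w)| ≤ ρ * (α * ρ + β + ‖w‖) := by
    rw [Model.cost, abs_neg]
    refine (abs_real_inner_le_norm _ _).trans ?_
    gcongr
    exact norm_add₃_le.trans (by gcongr)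
  calc M.cost x (j, w) ^ 2 ≤ (ρ * (α * ρ + β + ‖w‖)) ^ 2 := sq_le_sq' (by linarith [abs_le.1 h3])
        (le_of_abs_le h3)
    _ = ρ ^ 2 * (α * ρ + β + ‖w‖) ^ 2 := by ring
    _ ≤ ρ ^ 2 * (2 * ((α * ρ + β) ^ 2 + 1) * (1 + ‖w‖ ^ 2)) := by
        gcongr
        nlinarith [sq_nonneg (α * ρ + β - ‖w‖), sq_nonneg ((α * ρ + β) * ‖w‖)]
    _ = _ := by ring

theorem Model.integrable_sq_noise (hM : M.IsAdmissible) (i : Fin K) :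
    Integrable (fun z : Fin K × Vec n => ‖z.2‖ ^ 2) (M.nextLaw i) :=
  Model.integrable_nextLaw i (by fun_prop) fun j => (hM.memLp j).norm.integrable_sq

theorem Model.memLp_cost (hM : M.IsAdmissible) (i : Fin K) (x : Vec n) :
    MemLp (M.cost x) 2 (M.nextLaw i) := by
  have := M.isProbabilityMeasure_nextLaw hM i
  obtain ⟨C, -, hC⟩ := M.exists_sq_cost_le ‖x‖
  refine (memLp_two_iff_integrable_sq (M.measurable_cost_right x).aestronglyMeasurable).2 ?_
  refine Integrable.mono' (((integrable_const (1 : ℝ)).add (M.integrable_sq_noise hM i)).const_mul C)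
    ((M.measurable_cost_right x).pow_const 2).aestronglyMeasurable (ae_of_all _ fun z => ?_)
  rw [Real.norm_of_nonneg (sq_nonneg _)]
  exact hC x le_rfl z

theorem Model.integral_cost (hM : M.IsAdmissible) (i : Fin K) (x : Vec n) :
    ∫ z, M.cost x z ∂M.nextLaw i = M.stageCost i x := by
  refine Model.integral_nextLaw hM i (M.measurable_cost_right x) fun j => ?_
  have := hM.isProb j
  have hi : Integrable (fun w : Vec n => w) (M.f j) := (hM.memLp j).integrable (by norm_num)
  exact (((integrable_const (Matrix.toEuclideanLin (M.A j) x + M.b j)).add hi).const_inner x).neg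

theorem Model.exists_integral_sq_cost_le (hM : M.IsAdmissible) (ρ : ℝ) :
    ∃ C, 0 ≤ C ∧ ∀ i, ∀ x : Vec n, ‖x‖ ≤ ρ → ∫ z, M.cost x z ^ 2 ∂M.nextLaw i ≤ C := by
  obtain ⟨C, hC0, hC⟩ := M.exists_sq_cost_le ρ
  have hI : ∀ i, 0 ≤ ∫ z, C * (1 + ‖z.2‖ ^ 2) ∂M.nextLaw i := fun i =>
    integral_nonneg fun z => by positivity
  refine ⟨∑ i, ∫ z, C * (1 + ‖z.2‖ ^ 2) ∂M.nextLaw i, Finset.sum_nonneg fun i _ => hI i,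
    fun i x hx => ?_⟩
  have := M.isProbabilityMeasure_nextLaw hM i
  refine le_trans (integral_mono (M.memLp_cost hM i x).integrable_sq
    (((integrable_const (1 : ℝ)).add (M.integrable_sq_noise hM i)).const_mul C) (hC x hx)) ?_
  exact Finset.single_le_sum (f := fun i => ∫ z, C * (1 + ‖z.2‖ ^ 2) ∂M.nextLaw i)
    (fun i _ => hI i) (Finset.mem_univ i)

end Cost

/-! ### Moments of the perturbation vector and of its reciprocal. -/

section PerturbationLaw

variable {n : ℕ} {ν : Measure ℝ} {ξ₁ ξ₂ : ℝ}

/-- The vector of the reciprocals of the entries. -/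
noncomputable def recip {n : ℕ} (v : Vec n) : Vec n := WithLp.toLp 2 (fun j => 1 / v j)

theorem measurable_recip : Measurable (recip : Vec n → Vec n) := by
  refine (WithLp.measurable_toLp 2 _).comp (measurable_pi_lambda _ fun j => ?_)
  have : Measurable fun v : Vec n => v j := by fun_prop
  simp only [one_div]
  exact this.inv

/-- The law of a vector with independent entries of law `ν`. -/
noncomputable def vecLaw (ν : Measure ℝ) (n : ℕ) : Measure (Vec n) :=
  (Measure.pi fun _ : Fin n => ν).map (WithLp.toLp 2)

theorem isProbabilityMeasure_vecLaw [IsProbabilityMeasure ν] :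
    IsProbabilityMeasure (vecLaw ν n) :=
  Measure.isProbabilityMeasure_map (WithLp.measurable_toLp 2 _).aemeasurable

theorem IsPerturbationLaw.ae_ne_zero (h : IsPerturbationLaw ν ξ₁ ξ₂) : ∀ᵐ z ∂ν, z ≠ 0 := by
  have hm : Measurable fun z : ℝ => (ENNReal.ofReal (z ^ 2))⁻¹ := by fun_prop
  filter_upwards [ae_lt_top hm (h.inv_sq.trans_lt ENNReal.ofReal_lt_top).ne] with z hz h0
  simp [h0] at hz

theorem IsPerturbationLaw.memLp_id (h : IsPerturbationLaw ν ξ₁ ξ₂) :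
    MemLp (fun z : ℝ => z) 2 ν := by
  have := h.isProb
  exact MemLp.of_bound measurable_id.aestronglyMeasurable ξ₁ h.bounded

/-- The real and the extended reciprocal disagree only at zero, which is a null set for `ν`. -/
theorem IsPerturbationLaw.lintegral_inv_sq_le (h : IsPerturbationLaw ν ξ₁ ξ₂) :
    ∫⁻ z, ENNReal.ofReal ((1 / z) ^ 2) ∂ν ≤ ENNReal.ofReal ξ₂ := by
  refine le_trans (lintegral_mono_ae ?_) h.inv_sq
  filter_upwards [h.ae_ne_zero] with z hz
  rw [one_div, inv_pow, ENNReal.ofReal_inv_of_pos (by positivity)]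

theorem IsPerturbationLaw.integrable_inv_sq (h : IsPerturbationLaw ν ξ₁ ξ₂) :
    Integrable (fun z : ℝ => (1 / z) ^ 2) ν := by
  refine ⟨by simp only [one_div]; exact (measurable_inv.pow_const 2).aestronglyMeasurable, ?_⟩
  rw [hasFiniteIntegral_iff_ofReal (ae_of_all _ fun z => sq_nonneg _)]
  exact h.lintegral_inv_sq_le.trans_lt ENNReal.ofReal_lt_top

/-- The maximum with `0` replaces a sign condition on `ξ₂`. -/
theorem IsPerturbationLaw.integral_inv_sq_le (h : IsPerturbationLaw ν ξ₁ ξ₂) :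
    ∫ z, (1 / z) ^ 2 ∂ν ≤ max ξ₂ 0 := by
  rw [integral_eq_lintegral_of_nonneg_ae (ae_of_all _ fun z => sq_nonneg _)
    h.integrable_inv_sq.aestronglyMeasurable]
  exact ENNReal.toReal_le_of_le_ofReal (le_max_right _ _)
    (h.lintegral_inv_sq_le.trans (ENNReal.ofReal_le_ofReal (le_max_left _ _)))

theorem IsPerturbationLaw.memLp_inv (h : IsPerturbationLaw ν ξ₁ ξ₂) :
    MemLp (fun z : ℝ => 1 / z) 2 ν := by
  refine (memLp_two_iff_integrable_sq ?_).2 h.integrable_inv_sq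
  simp only [one_div]
  exact measurable_inv.aestronglyMeasurable

theorem IsPerturbationLaw.integral_id (h : IsPerturbationLaw ν ξ₁ ξ₂) : ∫ z, z ∂ν = 0 := by
  have h1 : ∫ z, z ∂ν = ∫ z, -z ∂ν := by
    conv_lhs => rw [← h.symm]
    exact integral_map measurable_neg.aemeasurable measurable_id.aestronglyMeasurable
  rw [integral_neg] at h1
  linarith

theorem integral_pi_eval [IsProbabilityMeasure ν] {f : ℝ → ℝ} (hf : AEStronglyMeasurable f ν)
    (j : Fin n) : ∫ x : Fin n → ℝ, f (x j) ∂(Measure.pi fun _ => ν) = ∫ z, f z ∂ν := by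
  have mp : MeasurePreserving (Function.eval j) (Measure.pi fun _ : Fin n => ν) ν :=
    measurePreserving_eval (fun _ => ν) j
  have h := integral_map mp.measurable.aemeasurable (f := f) (by rwa [mp.map_eq])
  rw [mp.map_eq] at h
  exact h.symm

/-- On the diagonal the product is almost surely `1`. Off the diagonal the factors are independent
and `x l` has mean zero by symmetry; `1 / x j` only needs to be integrable. -/
theorem IsPerturbationLaw.pi_mul (h : IsPerturbationLaw ν ξ₁ ξ₂) (j l : Fin n) :
    Integrable (fun x : Fin n → ℝ => 1 / x j * x l) (Measure.pi fun _ => ν) ∧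
      ∫ x : Fin n → ℝ, 1 / x j * x l ∂(Measure.pi fun _ => ν) = if j = l then 1 else 0 := by
  have := h.isProb
  have mp : ∀ j, MeasurePreserving (Function.eval j) (Measure.pi fun _ : Fin n => ν) ν :=
    measurePreserving_eval fun _ => ν
  have m1 : MemLp (fun x : Fin n → ℝ => 1 / x j) 2 (Measure.pi fun _ => ν) :=
    h.memLp_inv.comp_measurePreserving (mp j)
  have m2 : MemLp (fun x : Fin n → ℝ => x l) 2 (Measure.pi fun _ => ν) :=
    h.memLp_id.comp_measurePreserving (mp l)
  refine ⟨m1.integrable_mul m2, ?_⟩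
  split_ifs with hjl
  · subst hjl
    have : ∀ᵐ x ∂(Measure.pi fun _ : Fin n => ν), 1 / x j * x j = 1 := by
      filter_upwards [(mp j).quasiMeasurePreserving.ae h.ae_ne_zero] with x hx
      exact one_div_mul_cancel hx
    rw [integral_congr_ae this]
    simp
  · have hind : IndepFun (fun x : Fin n → ℝ => x j) (fun x => x l) (Measure.pi fun _ => ν) :=
      (iIndepFun_pi (X := fun _ : Fin n => (id : ℝ → ℝ))
        (fun _ => aemeasurable_id)).indepFun hjl
    have hind' : IndepFun (fun x : Fin n → ℝ => 1 / x j) (fun x => x l) (Measure.pi fun _ => ν) :=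
      hind.comp (φ := fun z => 1 / z) (ψ := id) (by simpa only [one_div] using measurable_inv)
        measurable_id
    rw [hind'.integral_fun_mul_eq_mul_integral m1.aestronglyMeasurable m2.aestronglyMeasurable]
    rw [integral_pi_eval (f := fun z => z) measurable_id.aestronglyMeasurable l, h.integral_id,
      mul_zero]

/-- This is why multiplying a directional difference by the reciprocals recovers the full gradient
in the mean. -/
theorem IsPerturbationLaw.vecLaw_inner_mul (h : IsPerturbationLaw ν ξ₁ ξ₂) (y v : Vec n) :
    Integrable (fun d => ⟪y, recip d⟫ * ⟪v, d⟫) (vecLaw ν n) ∧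
      ∫ d, ⟪y, recip d⟫ * ⟪v, d⟫ ∂vecLaw ν n = ⟪y, v⟫ := by
  have hm : Measurable fun d : Vec n => ⟪y, recip d⟫ * ⟪v, d⟫ :=
    (measurable_recip.const_inner).mul measurable_id.const_inner
  have e : (fun x : Fin n → ℝ => ⟪y, recip (WithLp.toLp 2 x)⟫ * ⟪v, WithLp.toLp 2 x⟫)
      = fun x => ∑ j, ∑ l, y j * v l * (1 / x j * x l) := by
    ext x
    simp only [PiLp.inner_apply, recip, RCLike.inner_apply, RCLike.conj_to_real]
    rw [Finset.sum_mul_sum]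
    exact Finset.sum_congr rfl fun j _ => Finset.sum_congr rfl fun l _ => by ring
  have hi : ∀ j l, Integrable (fun x : Fin n → ℝ => y j * v l * (1 / x j * x l))
      (Measure.pi fun _ => ν) := fun j l => (h.pi_mul j l).1.const_mul _
  have hae := (WithLp.measurable_toLp 2 (Fin n → ℝ)).aemeasurable
    (μ := Measure.pi fun _ : Fin n => ν)
  constructor
  · refine (integrable_map_measure hm.aestronglyMeasurable hae).2 ?_
    rw [Function.comp_def, e]
    exact integrable_finsetSum _ fun j _ => integrable_finsetSum _ fun l _ => hi j l
  · rw [vecLaw, integral_map hae hm.aestronglyMeasurable, e,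
      integral_finsetSum _ fun j _ => integrable_finsetSum _ fun l _ => hi j l]
    simp only [PiLp.inner_apply, RCLike.inner_apply, RCLike.conj_to_real]
    refine Finset.sum_congr rfl fun j _ => ?_
    rw [integral_finsetSum _ fun l _ => hi j l]
    simp only [integral_const_mul, (h.pi_mul _ _).2]
    simp [mul_comm]

theorem IsPerturbationLaw.vecLaw_norm_sq_recip (h : IsPerturbationLaw ν ξ₁ ξ₂) :
    Integrable (fun d => ‖recip d‖ ^ 2) (vecLaw ν n) ∧
      ∫ d, ‖recip d‖ ^ 2 ∂vecLaw ν n ≤ n * max ξ₂ 0 := by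
  have := h.isProb
  have mp : ∀ j, MeasurePreserving (Function.eval j) (Measure.pi fun _ : Fin n => ν) ν :=
    measurePreserving_eval fun _ => ν
  have hm : Measurable fun d : Vec n => ‖recip d‖ ^ 2 := measurable_recip.norm.pow_const 2
  have e : (fun x : Fin n → ℝ => ‖recip (WithLp.toLp 2 x)‖ ^ 2)
      = fun x => ∑ j, (1 / x j) ^ 2 := by
    ext x
    simp [EuclideanSpace.norm_sq_eq, recip]
  have hi : ∀ j, Integrable (fun x : Fin n → ℝ => (1 / x j) ^ 2) (Measure.pi fun _ => ν) :=
    fun j => (mp j).integrable_comp_of_integrable h.integrable_inv_sq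
  have hae := (WithLp.measurable_toLp 2 (Fin n → ℝ)).aemeasurable
    (μ := Measure.pi fun _ : Fin n => ν)
  constructor
  · refine (integrable_map_measure hm.aestronglyMeasurable hae).2 ?_
    rw [Function.comp_def, e]
    exact integrable_finsetSum _ fun j _ => hi j
  · rw [vecLaw, integral_map hae hm.aestronglyMeasurable, e, integral_finsetSum _ fun j _ => hi j]
    have : ∀ j, ∫ x : Fin n → ℝ, (1 / x j) ^ 2 ∂(Measure.pi fun _ => ν) ≤ max ξ₂ 0 := fun j => by
      rw [integral_pi_eval (f := fun z => (1 / z) ^ 2) h.integrable_inv_sq.aestronglyMeasurable j]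
      exact h.integral_inv_sq_le
    refine (Finset.sum_le_sum fun j _ => this j).trans ?_
    simp

theorem norm_le_of_forall_abs_le {d : Vec n} {r : ℝ} (h : ∀ j, |d j| ≤ r) :
    ‖d‖ ≤ Real.sqrt (n * r ^ 2) := by
  rw [EuclideanSpace.norm_eq]
  refine Real.sqrt_le_sqrt ?_
  calc ∑ j, ‖d j‖ ^ 2 ≤ ∑ _j : Fin n, r ^ 2 :=
        Finset.sum_le_sum fun j _ => pow_le_pow_left₀ (norm_nonneg _) (h j) 2
    _ = _ := by simp

theorem IsPerturbationLaw.ae_norm_le (h : IsPerturbationLaw ν ξ₁ ξ₂) :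
    ∀ᵐ d ∂vecLaw ν n, ‖d‖ ≤ Real.sqrt (n * ξ₁ ^ 2) := by
  have := h.isProb
  have mp : ∀ j, MeasurePreserving (Function.eval j) (Measure.pi fun _ : Fin n => ν) ν :=
    measurePreserving_eval fun _ => ν
  refine (ae_map_iff (WithLp.measurable_toLp 2 (Fin n → ℝ)).aemeasurable
    (measurableSet_le measurable_norm measurable_const)).2 ?_
  filter_upwards [ae_all_iff.2 fun j => (mp j).quasiMeasurePreserving.ae h.bounded] with x hx
  exact norm_le_of_forall_abs_le fun j => hx j

end PerturbationLaw

/-! ### The mean effect of one pair of measurements on the squared error. -/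

section Step

theorem integral_const_add_mul_add_mul {α : Type*} [MeasurableSpace α] {q : Measure α}
    [IsProbabilityMeasure q] {f g : α → ℝ} (hf : Integrable f q) (hg : Integrable g q)
    (A B κ : ℝ) :
    ∫ z, A + B * f z + κ * g z ∂q = A + B * ∫ z, f z ∂q + κ * ∫ z, g z ∂q := by
  have h1 : Integrable (fun z => A + B * f z) q := (integrable_const A).add (hf.const_mul B)
  rw [integral_add h1 (hg.const_mul κ), integral_add (integrable_const A) (hf.const_mul B),
    integral_const_mul, integral_const_mul]
  simp

/-- A quadratic function of the difference of two independent square integrable variables. -/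
theorem lintegral_lintegral_quadratic_le {α : Type*} [MeasurableSpace α] (q : Measure α)
    [IsProbabilityMeasure q] {u v : α → ℝ} (hu : MemLp u 2 q) (hv : MemLp v 2 q) {C : ℝ}
    (huC : ∫ z, u z ^ 2 ∂q ≤ C) (hvC : ∫ z, v z ^ 2 ∂q ≤ C) {A B κ : ℝ} (hκ : 0 ≤ κ)
    (hF : ∀ z z', 0 ≤ A + B * (u z - v z') + κ * (u z - v z') ^ 2) :
    0 ≤ A + B * (∫ z, u z ∂q - ∫ z, v z ∂q) + κ * (4 * C) ∧
    ∫⁻ z, ∫⁻ z', ENNReal.ofReal (A + B * (u z - v z') + κ * (u z - v z') ^ 2) ∂q ∂q ≤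
      ENNReal.ofReal (A + B * (∫ z, u z ∂q - ∫ z, v z ∂q) + κ * (4 * C)) := by
  have hu' : MemLp (fun z : α × α => u z.1) 2 (q.prod q) := hu.comp_fst q
  have hv' : MemLp (fun z : α × α => v z.2) 2 (q.prod q) := hv.comp_snd q
  have hd : MemLp (fun z : α × α => u z.1 - v z.2) 2 (q.prod q) := hu'.sub hv'
  have i1 : Integrable (fun z : α × α => u z.1 - v z.2) (q.prod q) := hd.integrable (by norm_num)
  have i2 : Integrable (fun z : α × α => (u z.1 - v z.2) ^ 2) (q.prod q) := hd.integrable_sq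
  have iF : Integrable (fun z : α × α => A + B * (u z.1 - v z.2) + κ * (u z.1 - v z.2) ^ 2)
      (q.prod q) := ((integrable_const A).add (i1.const_mul B)).add (i2.const_mul κ)
  have e1 : ∫ z : α × α, u z.1 - v z.2 ∂q.prod q = ∫ z, u z ∂q - ∫ z, v z ∂q := by
    rw [integral_sub (hu'.integrable (by norm_num)) (hv'.integrable (by norm_num)),
      integral_fun_fst u, integral_fun_snd v]
    simp
  -- The factor `4` comes from `(u - v) ^ 2 ≤ 2 * u ^ 2 + 2 * v ^ 2`.
  have e2 : ∫ z : α × α, (u z.1 - v z.2) ^ 2 ∂q.prod q ≤ 4 * C := by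
    have h2 : ∫ z : α × α, (u z.1 - v z.2) ^ 2 ∂q.prod q
        ≤ ∫ z : α × α, 2 * u z.1 ^ 2 + 2 * v z.2 ^ 2 ∂q.prod q :=
      integral_mono i2 ((hu'.integrable_sq.const_mul 2).add (hv'.integrable_sq.const_mul 2))
        fun z => by
          show (u z.1 - v z.2) ^ 2 ≤ 2 * u z.1 ^ 2 + 2 * v z.2 ^ 2
          nlinarith [sq_nonneg (u z.1 + v z.2)]
    rw [integral_add (hu'.integrable_sq.const_mul 2) (hv'.integrable_sq.const_mul 2),
      integral_const_mul, integral_const_mul, integral_fun_fst (fun z => u z ^ 2),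
      integral_fun_snd (fun z => v z ^ 2)] at h2
    simp only [probReal_univ, one_smul] at h2
    linarith
  have e3 : ∫ z : α × α, A + B * (u z.1 - v z.2) + κ * (u z.1 - v z.2) ^ 2 ∂q.prod q
      ≤ A + B * (∫ z, u z ∂q - ∫ z, v z ∂q) + κ * (4 * C) := by
    rw [integral_const_add_mul_add_mul i1 i2, e1]
    gcongr
  refine ⟨(integral_nonneg fun z => hF z.1 z.2).trans e3, ?_⟩
  rw [lintegral_lintegral
    (f := fun z z' => ENNReal.ofReal (A + B * (u z - v z') + κ * (u z - v z') ^ 2))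
    iF.aestronglyMeasurable.aemeasurable.ennreal_ofReal,
    ← ofReal_integral_eq_lintegral_ofReal iF (ae_of_all _ fun z => hF z.1 z.2)]
  exact ENNReal.ofReal_le_ofReal e3

theorem norm_sub_smul_sub_sq {n : ℕ} (x o v : Vec n) (r : ℝ) :
    ‖x - r • v - o‖ ^ 2 = ‖x - o‖ ^ 2 + -2 * r * ⟪x - o, v⟫ + r ^ 2 * ‖v‖ ^ 2 := by
  rw [sub_right_comm, norm_sub_sq_real, inner_smul_right, norm_smul, mul_pow, Real.norm_eq_abs,
    sq_abs]
  ring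

/-- One step of simultaneous perturbation stochastic approximation decreases the mean squared
distance from the optimal input, up to a multiple of `(a / c) ^ 2`. -/
theorem lintegral_step_le {K n : ℕ} {M : Model K n} (hM : M.IsAdmissible) (i : Fin K)
    {ν : Measure ℝ} {ξ₁ ξ₂ : ℝ} (hν : IsPerturbationLaw ν ξ₁ ξ₂) {S : Set (Vec n)}
    (hc : Convex ℝ S) (hS : IsCompact S) (ho : M.optimalInput i ∈ S) {l : ℝ}
    (hl : ∀ y, l * ‖y‖ ^ 2 ≤ ⟪y, M.quad i y⟫) {R C : ℝ}
    (hC : ∀ x : Vec n, ‖x‖ ≤ R → ∫ z, M.cost x z ^ 2 ∂M.nextLaw i ≤ C) (hl0 : 0 ≤ l)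
    {x : Vec n} {a c : ℝ} (ha : 0 < a) (hc0 : 0 < c) (hxR : ‖x‖ + c * Real.sqrt (n * ξ₁ ^ 2) ≤ R) :
    ∫⁻ d, ∫⁻ z, ∫⁻ z', ENNReal.ofReal (‖proj S (x - (a * ((M.cost (x + c • d) z
        - M.cost (x - c • d) z') / c)) • recip d) - M.optimalInput i‖ ^ 2)
        ∂M.nextLaw i ∂M.nextLaw i ∂vecLaw ν n
        + ENNReal.ofReal (8 * l * a * ‖x - M.optimalInput i‖ ^ 2) ≤
      ENNReal.ofReal (‖x - M.optimalInput i‖ ^ 2) +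
        ENNReal.ofReal (4 * C * (n * max ξ₂ 0) * (a / c) ^ 2) := by
  have := hν.isProb
  have := isProbabilityMeasure_vecLaw (ν := ν) (n := n)
  have := M.isProbabilityMeasure_nextLaw hM i
  set o := M.optimalInput i with hodef
  set y := x - o with hy
  set v := M.quad i y + LinearMap.adjoint (M.quad i) y with hv
  set g : Vec n → ℝ := fun d => ‖y‖ ^ 2 + (-4 * a) * (⟪y, recip d⟫ * ⟪v, d⟫)
    + 4 * C * (a / c) ^ 2 * ‖recip d‖ ^ 2 with hg
  have hC0 : 0 ≤ C := (integral_nonneg fun z => sq_nonneg _).trans (hC x (by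
    refine le_trans ?_ hxR
    have : 0 ≤ c * Real.sqrt (n * ξ₁ ^ 2) := by positivity
    linarith))
  -- For a fixed direction `d`, average over the two measurements first; the average over `d` comes
  -- afterwards.
  have hinner : ∀ᵐ d ∂vecLaw ν n, 0 ≤ g d ∧
      ∫⁻ z, ∫⁻ z', ENNReal.ofReal (‖proj S (x - (a * ((M.cost (x + c • d) z
        - M.cost (x - c • d) z') / c)) • recip d) - o‖ ^ 2) ∂M.nextLaw i ∂M.nextLaw i
        ≤ ENNReal.ofReal (g d) := by
    filter_upwards [hν.ae_norm_le] with d hd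
    have hcd : ‖c • d‖ ≤ c * Real.sqrt (n * ξ₁ ^ 2) := by
      rw [norm_smul, Real.norm_of_nonneg hc0.le]
      gcongr
    have hp : ‖x + c • d‖ ≤ R := (norm_add_le _ _).trans (by linarith)
    have hm : ‖x - c • d‖ ≤ R := (norm_sub_le _ _).trans (by linarith)
    have hE : ∀ z z', ‖x - (a * ((M.cost (x + c • d) z - M.cost (x - c • d) z') / c)) • recip d
        - o‖ ^ 2 = ‖y‖ ^ 2 + (-2 * (a / c) * ⟪y, recip d⟫) * (M.cost (x + c • d) z
          - M.cost (x - c • d) z') + ((a / c) ^ 2 * ‖recip d‖ ^ 2) * (M.cost (x + c • d) z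
          - M.cost (x - c • d) z') ^ 2 := fun z z' => by
      rw [norm_sub_smul_sub_sq]
      ring
    have key := lintegral_lintegral_quadratic_le (M.nextLaw i) (M.memLp_cost hM i (x + c • d))
      (M.memLp_cost hM i (x - c • d)) (hC _ hp) (hC _ hm) (A := ‖y‖ ^ 2)
      (B := -2 * (a / c) * ⟪y, recip d⟫) (κ := (a / c) ^ 2 * ‖recip d‖ ^ 2) (by positivity)
      (fun z z' => by rw [← hE]; positivity)
    rw [M.integral_cost hM, M.integral_cost hM, M.stageCost_add_sub_stageCost_sub hM, ← hodef,
      ← hy, ← hv] at key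
    -- The gain `c` of the symmetric difference cancels the division by `c`, so the drift is of
    -- order `a` while the noise term keeps `(a / c) ^ 2`.
    have hgd : ‖y‖ ^ 2 + (-2 * (a / c) * ⟪y, recip d⟫) * (2 * c * ⟪v, d⟫)
        + ((a / c) ^ 2 * ‖recip d‖ ^ 2) * (4 * C) = g d := by
      rw [hg]
      field_simp
      ring
    rw [hgd] at key
    refine ⟨key.1, le_trans ?_ key.2⟩
    refine lintegral_mono fun z => lintegral_mono fun z' => ENNReal.ofReal_le_ofReal ?_
    rw [← hE]
    -- The optimal input is feasible, so dropping the projection only enlarges the error.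
    exact pow_le_pow_left₀ (norm_nonneg _) (norm_proj_sub_le hc hS ho _) 2
  have j1 := hν.vecLaw_inner_mul y v
  have j2 := hν.vecLaw_norm_sq_recip (n := n)
  have jg : Integrable g (vecLaw ν n) :=
    ((integrable_const _).add (j1.1.const_mul _)).add (j2.1.const_mul _)
  refine (add_le_add (lintegral_mono_ae (hinner.mono fun d h => h.2)) le_rfl).trans ?_
  rw [← ofReal_integral_eq_lintegral_ofReal jg (hinner.mono fun d h => h.1),
    ← ENNReal.ofReal_add (integral_nonneg_of_ae (hinner.mono fun d h => h.1)) (by positivity),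
    ← ENNReal.ofReal_add (by positivity) (by positivity)]
  refine ENNReal.ofReal_le_ofReal ?_
  rw [hg, integral_const_add_mul_add_mul j1.1 j2.1, j1.2]
  have hyv : ⟪y, v⟫ = 2 * ⟪y, M.quad i y⟫ := by
    rw [hv, inner_add_right, LinearMap.adjoint_inner_right, real_inner_comm y (M.quad i y)]
    ring
  have h1 : 8 * l * a * ‖y‖ ^ 2 ≤ 4 * a * ⟪y, v⟫ := by
    rw [hyv]
    nlinarith [mul_le_mul_of_nonneg_left (hl y) ha.le]
  have h2 : 4 * C * (a / c) ^ 2 * ∫ d, ‖recip d‖ ^ 2 ∂vecLaw ν n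
      ≤ 4 * C * (a / c) ^ 2 * (n * max ξ₂ 0) := mul_le_mul_of_nonneg_left j2.2 (by positivity)
  linarith

end Step

/-! ### The conditional law of perturbation, next state and noise given the past. -/

section Freshness

/-- Slicing over the finite factor reduces equality of measures to prescribed states, the form in
which the law of the model is given. -/
theorem ext_of_singleton_prod {α β : Type*} [Finite β] [MeasurableSpace β]
    [MeasurableSingletonClass β] [MeasurableSpace α] {ρ₁ ρ₂ : Measure (β × α)}
    (h : ∀ b (B : Set α), MeasurableSet B → ρ₁ ({b} ×ˢ B) = ρ₂ ({b} ×ˢ B)) : ρ₁ = ρ₂ := by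
  cases nonempty_fintype β
  have key : ∀ ρ : Measure (β × α), ∀ C, MeasurableSet C →
      ρ C = ∑ b, ρ ({b} ×ˢ (Prod.mk b ⁻¹' C)) := fun ρ C hC => by
    rw [← measure_biUnion_finset]
    · congr 1
      ext ⟨b, x⟩
      simp
    · intro b _ b' _ hb
      exact Set.disjoint_left.2 fun x hx hx' => hb (hx.1.symm.trans hx'.1)
    · exact fun b _ => (measurableSet_singleton b).prod (measurable_prodMk_left hC)
  ext C hC
  rw [key ρ₁ C hC, key ρ₂ C hC]
  exact Finset.sum_congr rfl fun b _ => h b _ (measurable_prodMk_left hC)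

variable {K n : ℕ} {M : Model K n} {Ω : Type*} [mΩ : MeasurableSpace Ω] {μ : Measure Ω}
  {s : ℕ → Ω → Fin K} {w D : ℕ → Ω → Vec n} {ν : Measure ℝ}

/-- The states up to time `t` and the noise vectors that have acted by then. -/
def modelHist (s : ℕ → Ω → Fin K) (w : ℕ → Ω → Vec n) (t : ℕ) (ω : Ω) :
    (Fin (t + 1) → Fin K) × (Fin t → Vec n) :=
  (fun r => s r ω, fun r => w r ω)

/-- The perturbation vectors of the first `t` stages. -/
def pertHist (D : ℕ → Ω → Vec n) (t : ℕ) (ω : Ω) : Fin t → Vec n := fun r => D r ω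

/-- The next state and the noise that comes with it. -/
def next (s : ℕ → Ω → Fin K) (w : ℕ → Ω → Vec n) (t : ℕ) (ω : Ω) : Fin K × Vec n :=
  (s (t + 1) ω, w t ω)

theorem Model.IsRealizedBy.measurable_modelHist (h : M.IsRealizedBy μ s w) (t : ℕ) :
    Measurable (modelHist s w t) :=
  Measurable.prodMk (f := fun ω (r : Fin (t + 1)) => s r ω) (g := fun ω (r : Fin t) => w r ω)
    (measurable_pi_lambda _ fun r => h.measurable_state r)
    (measurable_pi_lambda _ fun r => h.measurable_noise r)

theorem Model.IsRealizedBy.measurable_next (h : M.IsRealizedBy μ s w) (t : ℕ) :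
    Measurable (next s w t) :=
  (h.measurable_state _).prodMk (h.measurable_noise _)

theorem IsPerturbation.measurable_pertHist (h : IsPerturbation μ ν s w D) (t : ℕ) :
    Measurable (pertHist D t) :=
  measurable_pi_lambda _ fun r => h.measurable r

theorem IsPerturbation.indepFun_pertHist (h : IsPerturbation μ ν s w D) (t : ℕ) :
    IndepFun (pertHist D t) (D t) μ := by
  have hm : ∀ p : ℕ × Fin n, Measurable fun ω => D p.1 ω p.2 := fun p => by
    have := h.measurable p.1
    fun_prop
  have hd : Disjoint (Finset.range t ×ˢ (Finset.univ : Finset (Fin n)))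
      ({t} ×ˢ (Finset.univ : Finset (Fin n))) := by
    rw [Finset.disjoint_left]
    rintro ⟨a, b⟩ h1 h2
    simp only [Finset.mem_product, Finset.mem_range, Finset.mem_singleton] at h1 h2
    omega
  have hi := h.indep_entries.indepFun_finset _ _ hd hm
  refine hi.comp
    (φ := fun x (r : Fin t) => WithLp.toLp 2 fun j => x ⟨((r : ℕ), j), by simp [r.2]⟩)
    (ψ := fun x => WithLp.toLp 2 fun j => x ⟨(t, j), by simp⟩) ?_ ?_
  · exact measurable_pi_lambda _ fun r => (WithLp.measurable_toLp 2 _).comp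
      (measurable_pi_lambda _ fun j => measurable_pi_apply _)
  · exact (WithLp.measurable_toLp 2 _).comp
      (measurable_pi_lambda _ fun j => measurable_pi_apply _)

/-- What the policy has observed when it chooses its input at stage `t + 1`, together with the
past noise and perturbations. -/
def history (s : ℕ → Ω → Fin K) (w D : ℕ → Ω → Vec n) (t : ℕ) (ω : Ω) :
    ((Fin (t + 1) → Fin K) × (Fin t → Vec n)) × (Fin t → Vec n) :=
  (modelHist s w t ω, pertHist D t ω)

/-- The perturbation, the next state and the noise of stage `t + 1`. -/
def fresh (s : ℕ → Ω → Fin K) (w D : ℕ → Ω → Vec n) (t : ℕ) (ω : Ω) : Vec n × Fin K × Vec n :=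
  (D t ω, next s w t ω)

/-- The filtration generated by `history`. -/
def historyFiltration (h : M.IsRealizedBy μ s w) (hD : IsPerturbation μ ν s w D) :
    Filtration ℕ mΩ where
  seq t := MeasurableSpace.comap (history s w D t) inferInstance
  mono' := by
    refine monotone_nat_of_le_succ fun t => ?_
    rintro _ ⟨A, hA, rfl⟩
    refine ⟨(fun x : ((Fin (t + 2) → Fin K) × (Fin (t + 1) → Vec n)) × (Fin (t + 1) → Vec n) =>
      (((fun r : Fin (t + 1) => x.1.1 r.castSucc), fun r : Fin t => x.1.2 r.castSucc),
        fun r : Fin t => x.2 r.castSucc)) ⁻¹' A, ?_, rfl⟩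
    have : Measurable fun x : ((Fin (t + 2) → Fin K) × (Fin (t + 1) → Vec n)) ×
        (Fin (t + 1) → Vec n) =>
      (((fun r : Fin (t + 1) => x.1.1 r.castSucc), fun r : Fin t => x.1.2 r.castSucc),
        fun r : Fin t => x.2 r.castSucc) := by fun_prop
    exact this hA
  le' t := ((h.measurable_modelHist t).prodMk (hD.measurable_pertHist t)).comap_le

theorem measurable_state_history (h : M.IsRealizedBy μ s w) (hD : IsPerturbation μ ν s w D)
    (t : ℕ) : Measurable[historyFiltration h hD t] (s t) := by
  have h1 : Measurable[historyFiltration h hD t] (history s w D t) := comap_measurable _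
  have h2 : Measurable fun x : ((Fin (t + 1) → Fin K) × (Fin t → Vec n)) × (Fin t → Vec n) =>
    x.1.1 (Fin.last t) := by fun_prop
  exact h2.comp h1

theorem measurable_fresh_history (h : M.IsRealizedBy μ s w) (hD : IsPerturbation μ ν s w D)
    (t : ℕ) : Measurable[historyFiltration h hD (t + 1)] (fresh s w D t) := by
  have h1 : Measurable[historyFiltration h hD (t + 1)] (history s w D (t + 1)) :=
    comap_measurable _
  have h2 : Measurable fun x : ((Fin (t + 2) → Fin K) × (Fin (t + 1) → Vec n)) ×
      (Fin (t + 1) → Vec n) =>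
    (x.2 (Fin.last t), x.1.1 (Fin.last (t + 1)), x.1.2 (Fin.last t)) := by fun_prop
  exact h2.comp h1

variable [IsProbabilityMeasure μ]

/-- Passing from horizon `t` to `t + 1` in the law of the model adds one factor, which is exactly
the mass of `{j} ×ˢ B` under `nextLaw`. This settles boxes of noise sets; uniqueness of finite
measures on a generating π-system gives general `W`. -/
theorem Model.IsRealizedBy.measure_path (hM : M.IsAdmissible) (h : M.IsRealizedBy μ s w) (t : ℕ)
    (σ : Fin (t + 1) → Fin K) (j : Fin K) {W : Set (Fin t → Vec n)} (hW : MeasurableSet W)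
    {B : Set (Vec n)} (hB : MeasurableSet B) :
    μ (modelHist s w t ⁻¹' ({σ} ×ˢ W) ∩ next s w t ⁻¹' ({j} ×ˢ B)) =
      μ (modelHist s w t ⁻¹' ({σ} ×ˢ W)) * M.nextLaw (σ (Fin.last t)) ({j} ×ˢ B) := by
  have hmw : Measurable fun ω => (modelHist s w t ω).2 := measurable_snd.comp
    (h.measurable_modelHist t)
  have hms : Measurable fun ω => (modelHist s w t ω).1 := measurable_fst.comp
    (h.measurable_modelHist t)
  have hN : MeasurableSet (next s w t ⁻¹' ({j} ×ˢ B)) :=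
    h.measurable_next t ((measurableSet_singleton j).prod hB)
  have hσ : MeasurableSet {ω | (modelHist s w t ω).1 = σ} := hms (measurableSet_singleton σ)
  have := M.isProbabilityMeasure_nextLaw hM (σ (Fin.last t))
  set κ := M.nextLaw (σ (Fin.last t)) ({j} ×ˢ B) with hκ
  have hκ1 : κ ≠ ⊤ := measure_ne_top _ _
  have : IsFiniteMeasure (κ • (μ.restrict {ω | (modelHist s w t ω).1 = σ}).map
      fun ω => (modelHist s w t ω).2) := Measure.smul_finite _ hκ1
  have hext : (μ.restrict ({ω | (modelHist s w t ω).1 = σ} ∩ next s w t ⁻¹' ({j} ×ˢ B))).map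
      (fun ω => (modelHist s w t ω).2) =
      κ • (μ.restrict {ω | (modelHist s w t ω).1 = σ}).map fun ω => (modelHist s w t ω).2 := by
    have hbox : ∀ A ∈ Set.pi Set.univ '' Set.pi Set.univ fun _ : Fin t =>
        {B : Set (Vec n) | MeasurableSet B},
        (μ.restrict ({ω | (modelHist s w t ω).1 = σ} ∩ next s w t ⁻¹' ({j} ×ˢ B))).map
          (fun ω => (modelHist s w t ω).2) A =
        (κ • (μ.restrict {ω | (modelHist s w t ω).1 = σ}).map
          fun ω => (modelHist s w t ω).2) A := by
      rintro _ ⟨E, hE, rfl⟩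
      have hE' : ∀ r, MeasurableSet (E r) := fun r => hE r trivial
      have hA : MeasurableSet (Set.pi Set.univ E) := MeasurableSet.univ_pi hE'
      rw [Measure.smul_apply, Measure.map_apply hmw hA, Measure.map_apply hmw hA,
        Measure.restrict_apply (hmw hA), Measure.restrict_apply (hmw hA)]
      -- The default values `j` and `B` beyond the past are precisely the requirements on the new
      -- state (index `t + 1`) and the new noise (index `t`).
      set σ' : ℕ → Fin K := fun r => if hr : r < t + 1 then σ ⟨r, hr⟩ else j with hσ'
      set B' : ℕ → Set (Vec n) := fun r => if hr : r < t then E ⟨r, hr⟩ else B with hB'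
      have hB'm : ∀ r, MeasurableSet (B' r) := fun r => by
        rw [hB']
        dsimp only
        split_ifs
        exacts [hE' _, hB]
      have e0 : σ' t = σ (Fin.last t) := by simp [hσ', Fin.last]
      have e1 : σ' (t + 1) = j := by simp [hσ']
      have e2 : B' t = B := by simp [hB']
      have hs : ∀ ω, (∀ r ≤ t, s r ω = σ' r) ↔ (modelHist s w t ω).1 = σ := fun ω => by
        rw [funext_iff]
        constructor
        · intro hh r
          have := hh r (Nat.lt_succ_iff.1 r.2)
          simp only [hσ', dif_pos r.2] at this
          exact this
        · intro hh r hr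
          have := hh ⟨r, Nat.lt_succ_iff.2 hr⟩
          simp only [hσ', dif_pos (Nat.lt_succ_iff.2 hr)]
          exact this
      have hw : ∀ ω, (∀ r < t, w r ω ∈ B' r) ↔ (modelHist s w t ω).2 ∈ Set.pi Set.univ E :=
        fun ω => by
        rw [Set.mem_univ_pi]
        constructor
        · intro hh r
          have := hh r r.2
          simpa [hB', r.2, modelHist] using this
        · intro hh r hr
          have := hh ⟨r, hr⟩
          simpa [hB', hr, modelHist] using this
      have s1 : (fun ω => (modelHist s w t ω).2) ⁻¹' Set.pi Set.univ E ∩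
          {ω | (modelHist s w t ω).1 = σ} =
          {ω | (∀ r ≤ t, s r ω = σ' r) ∧ ∀ r < t, w r ω ∈ B' r} := by
        ext ω
        rw [Set.mem_inter_iff, Set.mem_ofPred_eq, Set.mem_ofPred_eq, hs, hw, and_comm]
        rfl
      have s2 : (fun ω => (modelHist s w t ω).2) ⁻¹' Set.pi Set.univ E ∩
          ({ω | (modelHist s w t ω).1 = σ} ∩ next s w t ⁻¹' ({j} ×ˢ B)) =
          {ω | (∀ r ≤ t + 1, s r ω = σ' r) ∧ ∀ r < t + 1, w r ω ∈ B' r} := by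
        rw [← Set.inter_assoc, s1]
        ext ω
        simp only [Set.mem_inter_iff, Set.mem_ofPred_eq, Set.mem_preimage, Set.mem_prod,
          Set.mem_singleton_iff, next]
        constructor
        · rintro ⟨⟨h1, h2⟩, h3, h4⟩
          refine ⟨fun r hr => ?_, fun r hr => ?_⟩
          · rcases Nat.le_succ_iff.1 hr with hr | rfl
            · exact h1 r hr
            · rw [e1]; exact h3
          · rcases Nat.lt_succ_iff_lt_or_eq.1 hr with hr | rfl
            · exact h2 r hr
            · rw [e2]; exact h4
        · rintro ⟨h1, h2⟩
          exact ⟨⟨fun r hr => h1 r (hr.trans (Nat.le_succ t)), fun r hr => h2 r (hr.trans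
            (Nat.lt_succ_self t))⟩, e1 ▸ h1 (t + 1) le_rfl, e2 ▸ h2 t (Nat.lt_succ_self t)⟩
      rw [s1, s2, h.law _ _ _ hB'm, h.law _ _ _ hB'm, Finset.prod_range_succ, e0, e1, e2, hκ,
        M.nextLaw_singleton_prod _ _ hB, smul_eq_mul, ← mul_assoc, mul_comm]
    refine ext_of_generate_finite _ generateFrom_pi.symm isPiSystem_pi hbox (hbox _ ?_)
    exact ⟨fun _ => Set.univ, fun _ _ => MeasurableSet.univ (α := Vec n), by simp⟩
  have e := congrArg (fun ρ => ρ W) hext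
  simp only [Measure.smul_apply] at e
  rw [Measure.map_apply hmw hW, Measure.map_apply hmw hW,
    Measure.restrict_apply (hmw hW), Measure.restrict_apply (hmw hW), smul_eq_mul, mul_comm] at e
  have t1 : modelHist s w t ⁻¹' ({σ} ×ˢ W) =
      (fun ω => (modelHist s w t ω).2) ⁻¹' W ∩ {ω | (modelHist s w t ω).1 = σ} := by
    ext ω
    exact and_comm
  rw [t1, ← e, Set.inter_assoc]

/-- The Markov property: among the finitely many paths, those ending in `i` all have the same
transition factor, and the others miss the event. -/
theorem Model.IsRealizedBy.measure_next (hM : M.IsAdmissible) (h : M.IsRealizedBy μ s w) (t : ℕ)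
    (i : Fin K) {A : Set ((Fin (t + 1) → Fin K) × (Fin t → Vec n))} (hA : MeasurableSet A)
    {C : Set (Fin K × Vec n)} (hC : MeasurableSet C) :
    μ (modelHist s w t ⁻¹' A ∩ {ω | s t ω = i} ∩ next s w t ⁻¹' C) =
      μ (modelHist s w t ⁻¹' A ∩ {ω | s t ω = i}) * M.nextLaw i C := by
  have hi : MeasurableSet {ω | s t ω = i} := h.measurable_state t (measurableSet_singleton i)
  have hh := h.measurable_modelHist t
  have hn := h.measurable_next t
  have step : ∀ j (B : Set (Vec n)), MeasurableSet B →
      μ (modelHist s w t ⁻¹' A ∩ {ω | s t ω = i} ∩ next s w t ⁻¹' ({j} ×ˢ B)) =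
      μ (modelHist s w t ⁻¹' A ∩ {ω | s t ω = i}) * M.nextLaw i ({j} ×ˢ B) := by
    intro j B hB
    have hN : MeasurableSet (next s w t ⁻¹' ({j} ×ˢ B)) :=
      hn ((measurableSet_singleton j).prod hB)
    have e : (μ.restrict ({ω | s t ω = i} ∩ next s w t ⁻¹' ({j} ×ˢ B))).map (modelHist s w t) =
        M.nextLaw i ({j} ×ˢ B) • (μ.restrict {ω | s t ω = i}).map (modelHist s w t) := by
      refine ext_of_singleton_prod fun σ W hW => ?_
      have hσW : MeasurableSet (({σ} : Set (Fin (t + 1) → Fin K)) ×ˢ W) :=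
        (measurableSet_singleton σ).prod hW
      rw [Measure.smul_apply, Measure.map_apply hh hσW, Measure.map_apply hh hσW,
        Measure.restrict_apply (hh hσW), Measure.restrict_apply (hh hσW)]
      have hlast : ∀ ω ∈ modelHist s w t ⁻¹' ({σ} ×ˢ W), s t ω = σ (Fin.last t) := fun ω hω => by
        have := congrFun hω.1 (Fin.last t)
        simpa [modelHist] using this
      by_cases hσ : σ (Fin.last t) = i
      · have e1 : modelHist s w t ⁻¹' ({σ} ×ˢ W) ∩ {ω | s t ω = i} =
            modelHist s w t ⁻¹' ({σ} ×ˢ W) :=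
          Set.inter_eq_left.2 fun ω hω => (hlast ω hω).trans hσ
        rw [← Set.inter_assoc, e1, h.measure_path hM t σ j hW hB, hσ, smul_eq_mul, mul_comm]
      · have e1 : modelHist s w t ⁻¹' ({σ} ×ˢ W) ∩ {ω | s t ω = i} = ∅ :=
          Set.eq_empty_of_forall_notMem fun ω hω => hσ ((hlast ω hω.1).symm.trans hω.2)
        rw [← Set.inter_assoc, e1]
        simp
    have e' := congrArg (fun ρ => ρ A) e
    simp only [Measure.smul_apply] at e'
    rw [Measure.map_apply hh hA, Measure.map_apply hh hA, Measure.restrict_apply (hh hA),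
      Measure.restrict_apply (hh hA), smul_eq_mul, mul_comm, ← Set.inter_assoc] at e'
    exact e'
  have e : (μ.restrict (modelHist s w t ⁻¹' A ∩ {ω | s t ω = i})).map (next s w t) =
      μ (modelHist s w t ⁻¹' A ∩ {ω | s t ω = i}) • M.nextLaw i := by
    refine ext_of_singleton_prod fun j B hB => ?_
    have hjB : MeasurableSet (({j} : Set (Fin K)) ×ˢ B) := (measurableSet_singleton j).prod hB
    rw [Measure.map_apply hn hjB, Measure.restrict_apply (hn hjB), Set.inter_comm, step j B hB,
      Measure.smul_apply, smul_eq_mul]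
  have e' := congrArg (fun ρ => ρ C) e
  simp only [Measure.smul_apply] at e'
  rw [Measure.map_apply hn hC, Measure.restrict_apply (hn hC), Set.inter_comm, smul_eq_mul] at e'
  exact e'

theorem IsPerturbation.map_eq (h : IsPerturbation μ ν s w D) (t : ℕ) :
    μ.map (D t) = vecLaw ν n := by
  have hm : ∀ p : ℕ × Fin n, Measurable fun ω => D p.1 ω p.2 := fun p => by
    have := h.measurable p.1
    fun_prop
  have hind : iIndepFun (fun (j : Fin n) ω => D t ω j) μ :=
    h.indep_entries.precomp (g := fun j : Fin n => (t, j)) fun a b hab => by simpa using hab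
  have e := (iIndepFun_iff_map_fun_eq_pi_map fun j => (hm (t, j)).aemeasurable).1 hind
  simp only [h.law] at e
  rw [vecLaw, ← e, Measure.map_map (WithLp.measurable_toLp 2 _)
    (measurable_pi_lambda _ fun j => hm (t, j))]
  rfl

/-- The law of `fresh` after the state `i`. -/
noncomputable def Model.freshLaw (M : Model K n) (ν : Measure ℝ) (i : Fin K) :
    Measure (Vec n × Fin K × Vec n) :=
  (vecLaw ν n).prod (M.nextLaw i)

/-- Combines three facts: perturbations are independent of the model, the present perturbation is
independent of past ones, and `measure_next`. They factor the measure of rectangles; the extension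
to measurable sets is done first for the history, then for the fresh variables. -/
theorem measure_history_fresh (hM : M.IsAdmissible) (h : M.IsRealizedBy μ s w)
    (hD : IsPerturbation μ ν s w D) [IsProbabilityMeasure ν] (t : ℕ) (i : Fin K)
    {A : Set (((Fin (t + 1) → Fin K) × (Fin t → Vec n)) × (Fin t → Vec n))} (hA : MeasurableSet A)
    {C : Set (Vec n × Fin K × Vec n)} (hC : MeasurableSet C) :
    μ (history s w D t ⁻¹' A ∩ {ω | s t ω = i} ∩ fresh s w D t ⁻¹' C) =
      μ (history s w D t ⁻¹' A ∩ {ω | s t ω = i}) * M.freshLaw ν i C := by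
  have := M.isProbabilityMeasure_nextLaw hM i
  have := isProbabilityMeasure_vecLaw (ν := ν) (n := n)
  have hi : MeasurableSet {ω | s t ω = i} := h.measurable_state t (measurableSet_singleton i)
  have hmh := h.measurable_modelHist t
  have hn := h.measurable_next t
  have hph := hD.measurable_pertHist t
  have hDt := hD.measurable t
  have hhist : Measurable (history s w D t) := hmh.prodMk hph
  have hfresh : Measurable (fresh s w D t) := hDt.prodMk hn
  have hind : IndepFun (fun ω => (pertHist D t ω, D t ω))
      (fun ω => (modelHist s w t ω, next s w t ω)) μ := by
    refine hD.indep_model.comp (φ := fun d => ((fun r : Fin t => d r), d t))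
      (ψ := fun q => (((fun r : Fin (t + 1) => q.1 r), (fun r : Fin t => q.2 r)),
        (q.1 (t + 1), q.2 t))) (by fun_prop) (by fun_prop)
  have hind' : ∀ {A₁ : Set (((Fin (t + 1) → Fin K) × (Fin t → Vec n)) × (Fin K × Vec n))}
      {A₂ : Set (Fin t → Vec n)} {C₁ : Set (Vec n)}, MeasurableSet A₁ → MeasurableSet A₂ →
      MeasurableSet C₁ → μ ((fun ω => (modelHist s w t ω, next s w t ω)) ⁻¹' A₁ ∩
        (pertHist D t ⁻¹' A₂ ∩ D t ⁻¹' C₁)) =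
        μ ((fun ω => (modelHist s w t ω, next s w t ω)) ⁻¹' A₁) *
          (μ (pertHist D t ⁻¹' A₂) * vecLaw ν n C₁) := by
    intro A₁ A₂ C₁ h1 h2 h3
    rw [← hD.map_eq t, Measure.map_apply hDt h3,
      ← (hD.indepFun_pertHist t).measure_inter_preimage_eq_mul _ _ h2 h3, mul_comm, Set.inter_comm]
    exact hind.measure_inter_preimage_eq_mul _ _ (h2.prod h3) h1
  have step : ∀ {C₁ : Set (Vec n)} {C₂ : Set (Fin K × Vec n)}, MeasurableSet C₁ →
      MeasurableSet C₂ →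
      μ (history s w D t ⁻¹' A ∩ {ω | s t ω = i} ∩ fresh s w D t ⁻¹' (C₁ ×ˢ C₂)) =
      μ (history s w D t ⁻¹' A ∩ {ω | s t ω = i}) * M.freshLaw ν i (C₁ ×ˢ C₂) := by
    intro C₁ C₂ h1 h2
    have e : (μ.restrict ({ω | s t ω = i} ∩ fresh s w D t ⁻¹' (C₁ ×ˢ C₂))).map (history s w D t) =
        M.freshLaw ν i (C₁ ×ˢ C₂) • (μ.restrict {ω | s t ω = i}).map (history s w D t) := by
      refine Measure.ext_prod fun {A₁ A₂} hA₁ hA₂ => ?_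
      have hA₁₂ := hhist (hA₁.prod hA₂)
      rw [Measure.smul_apply, Measure.map_apply hhist (hA₁.prod hA₂),
        Measure.map_apply hhist (hA₁.prod hA₂), Measure.restrict_apply hA₁₂,
        Measure.restrict_apply hA₁₂, smul_eq_mul, Model.freshLaw, Measure.prod_prod]
      have hlast : MeasurableSet {x : (Fin (t + 1) → Fin K) × (Fin t → Vec n) |
          x.1 (Fin.last t) = i} := by
        have : Measurable fun x : (Fin (t + 1) → Fin K) × (Fin t → Vec n) =>
          x.1 (Fin.last t) := by fun_prop
        exact this (measurableSet_singleton i)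
      have i1 := hind' ((hA₁.inter hlast).prod h2) hA₂ h1
      have i2 := hind' ((hA₁.inter hlast).prod MeasurableSet.univ) hA₂ MeasurableSet.univ
      have i3 := h.measure_next hM t i hA₁ h2
      have s1 : history s w D t ⁻¹' (A₁ ×ˢ A₂) ∩
          ({ω | s t ω = i} ∩ fresh s w D t ⁻¹' (C₁ ×ˢ C₂)) =
          (fun ω => (modelHist s w t ω, next s w t ω)) ⁻¹'
            ((A₁ ∩ {x | x.1 (Fin.last t) = i}) ×ˢ C₂) ∩
          (pertHist D t ⁻¹' A₂ ∩ D t ⁻¹' C₁) := by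
        ext ω
        simp only [history, fresh, modelHist, Set.mem_inter_iff, Set.mem_preimage, Set.mem_prod,
          Set.mem_ofPred_eq, Fin.val_last]
        tauto
      have s2 : history s w D t ⁻¹' (A₁ ×ˢ A₂) ∩ {ω | s t ω = i} =
          (fun ω => (modelHist s w t ω, next s w t ω)) ⁻¹'
            ((A₁ ∩ {x | x.1 (Fin.last t) = i}) ×ˢ Set.univ) ∩
          (pertHist D t ⁻¹' A₂ ∩ D t ⁻¹' Set.univ) := by
        ext ω
        simp only [history, modelHist, Set.mem_inter_iff, Set.mem_preimage, Set.mem_prod,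
          Set.mem_ofPred_eq, Fin.val_last, Set.mem_univ]
        tauto
      have s3 : (fun ω => (modelHist s w t ω, next s w t ω)) ⁻¹'
            ((A₁ ∩ {x | x.1 (Fin.last t) = i}) ×ˢ C₂) =
          modelHist s w t ⁻¹' A₁ ∩ {ω | s t ω = i} ∩ next s w t ⁻¹' C₂ := by
        ext ω
        simp [modelHist]
      have s4 : (fun ω => (modelHist s w t ω, next s w t ω)) ⁻¹'
            ((A₁ ∩ {x | x.1 (Fin.last t) = i}) ×ˢ Set.univ) =
          modelHist s w t ⁻¹' A₁ ∩ {ω | s t ω = i} := by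
        ext ω
        simp [modelHist]
      rw [s1, s2, i1, i2, s3, s4, i3, measure_univ]
      ring
    have e' := congrArg (fun ρ => ρ A) e
    simp only [Measure.smul_apply] at e'
    rw [Measure.map_apply hhist hA, Measure.map_apply hhist hA, Measure.restrict_apply (hhist hA),
      Measure.restrict_apply (hhist hA), smul_eq_mul, mul_comm, ← Set.inter_assoc] at e'
    exact e'
  have e : (μ.restrict (history s w D t ⁻¹' A ∩ {ω | s t ω = i})).map (fresh s w D t) =
      μ (history s w D t ⁻¹' A ∩ {ω | s t ω = i}) • M.freshLaw ν i := by
    refine Measure.ext_prod fun {C₁ C₂} h1 h2 => ?_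
    rw [Measure.map_apply hfresh (h1.prod h2), Measure.restrict_apply (hfresh (h1.prod h2)),
      Set.inter_comm, step h1 h2, Measure.smul_apply, smul_eq_mul]
  have e' := congrArg (fun ρ => ρ C) e
  simp only [Measure.smul_apply] at e'
  rw [Measure.map_apply hfresh hC, Measure.restrict_apply (hfresh hC), Set.inter_comm,
    smul_eq_mul] at e'
  exact e'

/-- Given the history, the mean over the fresh variables is taken under `freshLaw`. -/
theorem setLIntegral_fresh (hM : M.IsAdmissible) (h : M.IsRealizedBy μ s w)
    (hD : IsPerturbation μ ν s w D) [IsProbabilityMeasure ν] (t : ℕ) (i : Fin K) {A : Set Ω}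
    (hA : MeasurableSet[historyFiltration h hD t] A) {𝓧 : Type*} [MeasurableSpace 𝓧] {X : Ω → 𝓧}
    (hX : Measurable[historyFiltration h hD t] X)
    {φ : 𝓧 × (Vec n × Fin K × Vec n) → ENNReal} (hφ : Measurable φ) :
    ∫⁻ ω in A ∩ {ω | s t ω = i}, φ (X ω, fresh s w D t ω) ∂μ =
      ∫⁻ ω in A ∩ {ω | s t ω = i}, ∫⁻ u, φ (X ω, u) ∂M.freshLaw ν i ∂μ := by
  have := M.isProbabilityMeasure_nextLaw hM i
  have := isProbabilityMeasure_vecLaw (ν := ν) (n := n)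
  have : IsProbabilityMeasure (M.freshLaw ν i) := by
    unfold Model.freshLaw
    infer_instance
  have hX' : Measurable X := hX.mono ((historyFiltration h hD).le t) le_rfl
  have hfresh : Measurable (fresh s w D t) := (hD.measurable t).prodMk (h.measurable_next t)
  -- On this event the joint law is a product measure, so the claim is Tonelli's theorem.
  have e : (μ.restrict (A ∩ {ω | s t ω = i})).map (fun ω => (X ω, fresh s w D t ω)) =
      ((μ.restrict (A ∩ {ω | s t ω = i})).map X).prod (M.freshLaw ν i) := by
    refine Measure.ext_prod fun {S C} hS hC => ?_
    rw [Measure.map_apply (hX'.prodMk hfresh) (hS.prod hC),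
      Measure.restrict_apply ((hX'.prodMk hfresh) (hS.prod hC)), Measure.prod_prod,
      Measure.map_apply hX' hS, Measure.restrict_apply (hX' hS)]
    obtain ⟨A', hA', e'⟩ := (@MeasurableSet.inter _ (historyFiltration h hD t) _ _ hA (hX hS))
    have key := measure_history_fresh hM h hD t i hA' hC
    rw [e'] at key
    have s1 : (fun ω => (X ω, fresh s w D t ω)) ⁻¹' (S ×ˢ C) ∩ (A ∩ {ω | s t ω = i}) =
        A ∩ X ⁻¹' S ∩ {ω | s t ω = i} ∩ fresh s w D t ⁻¹' C := by
      ext ω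
      simp only [Set.mem_inter_iff, Set.mem_preimage, Set.mem_prod]
      tauto
    have s2 : X ⁻¹' S ∩ (A ∩ {ω | s t ω = i}) = A ∩ X ⁻¹' S ∩ {ω | s t ω = i} := by
      ext ω
      simp only [Set.mem_inter_iff]
      tauto
    rw [s1, s2, key]
  rw [← lintegral_map (f := φ) hφ (hX'.prodMk hfresh), e, lintegral_prod _ hφ.aemeasurable,
    lintegral_map hφ.lintegral_prod_right' hX']

end Freshness

/-! ### Decoupling of the states; step sizes and gains. -/

section Slots

variable {K n : ℕ}

/-- The memory of the policy that belongs to one state: estimate, counter, flag, last perturbation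
and last observed cost. -/
abbrev Slot (n : ℕ) : Type := Vec n × ℕ × Bool × Vec n × ℝ

def Memory.slot (m : Memory K n) (i : Fin K) : Slot n :=
  (m.est i, m.count i, m.flag i, m.pert i, m.dplus i)

noncomputable def Params.slotInput (p : Params K n) (i : Fin K) (l : Slot n) (d : Vec n) : Vec n :=
  if l.2.2.1 = false then l.1 + p.c i (l.2.1 + 1) • d else l.1 - p.c i l.2.1 • l.2.2.2.1

/-- The slot of the state `i` after a stage at which `i` was observed; `u` consists of the fresh
perturbation, the next state and the noise. -/
noncomputable def Params.slotNext (p : Params K n) (M : Model K n) (i : Fin K) (l : Slot n)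
    (u : Vec n × Fin K × Vec n) : Slot n :=
  if l.2.2.1 = false then (l.1, l.2.1 + 1, true, u.1, M.cost (p.slotInput i l u.1) u.2)
  else (proj p.feasible (l.1 - (p.a i l.2.1 *
    ((l.2.2.2.2 - M.cost (p.slotInput i l u.1) u.2) / p.c i l.2.1)) • recip l.2.2.2.1),
    l.2.1, false, l.2.2.2.1, l.2.2.2.2)

/-- Slots do not interact: a stage changes only the slot of the observed state, by a map of that
slot and the fresh variables. -/
theorem Params.slot_run_succ (p : Params K n) (M : Model K n) (s : ℕ → Fin K) (w D : ℕ → Vec n)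
    (i : Fin K) (t : ℕ) :
    (p.run M s w D (t + 1)).slot i = if s t = i then
      p.slotNext M i ((p.run M s w D t).slot i) (D t, s (t + 1), w t)
      else (p.run M s w D t).slot i := by
  rw [Params.run]
  generalize p.run M s w D t = m
  by_cases hi : s t = i
  · subst hi
    rw [if_pos rfl]
    have hin : p.input m (s t) (D t) = p.slotInput (s t) (m.slot (s t)) (D t) := rfl
    simp only [Params.update, Params.slotNext, Model.cost, hin]
    generalize p.slotInput (s t) (m.slot (s t)) (D t) = x
    cases hf : m.flag (s t) <;> simp [Memory.slot, hf, recip]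
  · rw [if_neg hi]
    have hi' : i ≠ s t := fun h => hi h.symm
    cases hf : m.flag (s t) <;>
      simp [Params.update, Memory.slot, hf, Function.update_of_ne hi']

theorem Params.measurable_slotInput (p : Params K n) (i : Fin K) :
    Measurable fun q : Slot n × Vec n => p.slotInput i q.1 q.2 := by
  have hc : Measurable (p.c i) := measurable_of_countable _
  have hc' : Measurable fun k : ℕ => p.c i (k + 1) := measurable_of_countable _
  unfold Params.slotInput
  refine Measurable.ite ?_ (by fun_prop) (by fun_prop)
  have : Measurable fun q : Slot n × Vec n => q.1.2.2.1 := by fun_prop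
  exact this (measurableSet_singleton false)

theorem Params.measurable_slotNext (p : Params K n) (hp : p.IsAdmissible) (M : Model K n)
    (i : Fin K) :
    Measurable fun q : Slot n × (Vec n × Fin K × Vec n) => p.slotNext M i q.1 q.2 := by
  have ha : Measurable (p.a i) := measurable_of_countable _
  have hc : Measurable (p.c i) := measurable_of_countable _
  have hin : Measurable fun q : Slot n × (Vec n × Fin K × Vec n) => p.slotInput i q.1 q.2.1 :=
    (p.measurable_slotInput i).comp
      (f := fun q : Slot n × (Vec n × Fin K × Vec n) => (q.1, q.2.1)) (by fun_prop)
  have hcost : Measurable fun q : Slot n × (Vec n × Fin K × Vec n) =>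
      M.cost (p.slotInput i q.1 q.2.1) q.2.2 :=
    M.measurable_cost.comp (g := fun q : Vec n × Fin K × Vec n => M.cost q.1 q.2)
      (f := fun q : Slot n × (Vec n × Fin K × Vec n) => (p.slotInput i q.1 q.2.1, q.2.2))
      (hin.prodMk (by fun_prop))
  have hproj : Measurable (proj p.feasible) :=
    (continuous_proj hp.convex hp.compact ⟨_, hp.init_mem i⟩).measurable
  have hr : Measurable fun q : Slot n × (Vec n × Fin K × Vec n) => recip q.1.2.2.2.1 :=
    measurable_recip.comp (by fun_prop)
  unfold Params.slotNext
  refine Measurable.ite ?_ (by fun_prop) (by fun_prop)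
  have : Measurable fun q : Slot n × (Vec n × Fin K × Vec n) => q.1.2.2.1 := by fun_prop
  exact this (measurableSet_singleton false)

theorem Params.c_nonneg {p : Params K n} (hp : p.IsAdmissible) (i : Fin K) (k : ℕ) :
    0 ≤ p.c i k := by
  have := hp.γ'_pos i
  unfold Params.c
  positivity

theorem Params.c_le {p : Params K n} (hp : p.IsAdmissible) (i : Fin K) (k : ℕ) :
    p.c i k ≤ p.γ' i := by
  have h0 := hp.γ'_pos i
  unfold Params.c
  rcases Nat.eq_zero_or_pos (p.N' i + k) with h | h
  · have : ((p.N' i : ℝ) + k) = 0 := by exact_mod_cast h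
    -- Before the first visit the counter is `0`, and if also `N' = 0` the gain is `0` by the
    -- convention on division.
    rw [this, Real.zero_rpow (by norm_num), div_zero]
    exact h0.le
  · have : (1 : ℝ) ≤ (p.N' i : ℝ) + k := by exact_mod_cast h
    exact div_le_self h0.le (Real.one_le_rpow this (by norm_num))

theorem Params.c_pos {p : Params K n} (hp : p.IsAdmissible) (i : Fin K) (k : ℕ) :
    0 < p.c i (k + 1) := by
  have := hp.γ'_pos i
  unfold Params.c
  positivity

theorem Params.a_pos {p : Params K n} (hp : p.IsAdmissible) (i : Fin K) (k : ℕ) :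
    0 < p.a i (k + 1) := by
  have := hp.γ_pos i
  unfold Params.a
  positivity

theorem Params.tendsto_c (p : Params K n) (i : Fin K) :
    Tendsto (p.c i) atTop (𝓝 0) := by
  unfold Params.c
  refine Tendsto.div_atTop tendsto_const_nhds ?_
  exact (tendsto_rpow_atTop (by norm_num)).comp
    (tendsto_atTop_add_const_left _ _ tendsto_natCast_atTop_atTop)

theorem Params.tendsto_sum_a {p : Params K n} (hp : p.IsAdmissible) (i : Fin K) :
    Tendsto (fun N => ∑ k ∈ Finset.range N, p.a i (k + 1)) atTop atTop := by
  rw [← not_summable_iff_tendsto_nat_atTop_of_nonneg fun k => (p.a_pos hp i k).le]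
  have e : (fun k : ℕ => p.a i (k + 1)) = fun k : ℕ =>
      p.γ i * (fun k : ℕ => ((k : ℝ))⁻¹) (k + (p.N i + 1)) := by
    ext k
    simp only [Params.a, div_eq_mul_inv]
    push_cast
    ring_nf
  rw [e, summable_mul_left_iff (hp.γ_pos i).ne']
  exact fun h => Real.not_summable_natCast_inv
    ((summable_nat_add_iff (f := fun k : ℕ => ((k : ℝ))⁻¹) (p.N i + 1)).1 h)

/-- The squared quotient is of order `k ^ (1 / 2 - 2)`, a convergent series. -/
theorem Params.summable_sq_a_div_c {p : Params K n} (hp : p.IsAdmissible) (i : Fin K) :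
    Summable fun k => (p.a i (k + 1) / p.c i (k + 1)) ^ 2 := by
  have hs : Summable fun k : ℕ => ((k + 1 : ℕ) : ℝ) ^ (-(3 / 2) : ℝ) :=
    (summable_nat_add_iff 1).2 (Real.summable_nat_rpow.2 (by norm_num))
  refine Summable.of_nonneg_of_le (fun k => sq_nonneg _) (fun k => ?_)
    -- The offset is absorbed by `N' + x ≤ (N' + 1) * x` for `x ≥ 1`.
    (hs.mul_left ((p.γ i / p.γ' i) ^ 2 * ((p.N' i : ℝ) + 1) ^ (1 / 2 : ℝ)))
  have h1 := hp.γ_pos i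
  have h2 := hp.γ'_pos i
  set x : ℝ := ((k + 1 : ℕ) : ℝ) with hx
  have hx1 : 1 ≤ x := by rw [hx]; push_cast; linarith [Nat.cast_nonneg (α := ℝ) k]
  have hx0 : 0 < x := by linarith
  have hN : (0 : ℝ) ≤ p.N i := Nat.cast_nonneg _
  have hN' : (0 : ℝ) ≤ p.N' i := Nat.cast_nonneg _
  have hpos : 0 < (p.N' i : ℝ) + x := by linarith
  have e : (p.a i (k + 1) / p.c i (k + 1)) ^ 2 =
      (p.γ i / p.γ' i) ^ 2 * (((p.N' i : ℝ) + x) ^ (1 / 2 : ℝ) / ((p.N i : ℝ) + x) ^ 2) := by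
    have hr : (((p.N' i : ℝ) + x) ^ (1 / 4 : ℝ)) ^ 2 = ((p.N' i : ℝ) + x) ^ (1 / 2 : ℝ) := by
      rw [← Real.rpow_natCast, ← Real.rpow_mul hpos.le]
      norm_num
    rw [← hr]
    simp only [Params.a, Params.c, ← hx]
    field_simp
  rw [e, mul_assoc]
  gcongr
  have e2 : x ^ (-(3 / 2) : ℝ) = x ^ (1 / 2 : ℝ) / x ^ 2 := by
    rw [← Real.rpow_natCast, ← Real.rpow_sub hx0]
    norm_num
  rw [e2, ← mul_div_assoc, ← Real.mul_rpow (by positivity) hx0.le]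
  gcongr
  · nlinarith
  · linarith

end Slots

/-! ### Deterministic convergence along a single path. -/

section Path

/-- The estimates along a single path: `vis` marks the visits of the state, `k`, `f` and `v` are
the counter, the flag and the squared error, `Φ` is a convergent Lyapunov function. -/
theorem tendsto_of_lyapunov {vis : ℕ → Prop} [DecidablePred vis] {k : ℕ → ℕ} {f : ℕ → Bool}
    {v Φ α R : ℕ → ℝ} {c : ℝ} (hk0 : k 0 = 0)
    (hstay : ∀ t, ¬vis t → k (t + 1) = k t ∧ f (t + 1) = f t ∧ v (t + 1) = v t)
    (hplus : ∀ t, vis t → f t = false → k (t + 1) = k t + 1 ∧ f (t + 1) = true ∧ v (t + 1) = v t)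
    (hminus : ∀ t, vis t → f t = true → k (t + 1) = k t ∧ f (t + 1) = false)
    (hvis : ∃ᶠ t in atTop, vis t) (hv : ∀ t, 0 ≤ v t) (hα : ∀ m, 0 ≤ α m)
    (hαsum : Tendsto (fun N => ∑ m ∈ Finset.range N, α (m + 1)) atTop atTop)
    (hR : Tendsto R atTop (𝓝 0)) (hΦ0 : ∀ t, 0 ≤ Φ t) (hΦ : ∀ t, f t = false → Φ t = v t + R (k t))
    (hΦc : Tendsto Φ atTop (𝓝 c))
    (hsum : Summable fun t => if vis t ∧ f t = false then α (k t + 1) * v t else 0) :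
    Tendsto k atTop atTop ∧ Tendsto v atTop (𝓝 0) := by
  -- Visits alternate the flag, so infinitely many visits contain infinitely many first
  -- measurements.
  have hfreq : ∃ᶠ t in atTop, vis t ∧ f t = false := by
    intro hcon
    obtain ⟨N, hN⟩ := eventually_atTop.1 hcon
    obtain ⟨t, htN, ht⟩ := frequently_atTop.1 hvis N
    have hft : f t = true := by
      by_contra h
      exact hN t htN ⟨ht, by simpa using h⟩
    have hall : ∀ r, t + 1 ≤ r → f r = false := fun r hr => by
      induction r, hr using Nat.le_induction with
      | base => exact (hminus t ht hft).2
      | succ r hr ih =>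
        have hnv : ¬vis r := fun h => hN r (by omega) ⟨h, ih⟩
        exact (hstay r hnv).2.1.trans ih
    obtain ⟨r, hr, hvr⟩ := frequently_atTop.1 hvis (t + 1)
    exact hN r (by omega) ⟨hvr, hall r hr⟩
  have hmono : Monotone k := monotone_nat_of_le_succ fun t => by
    by_cases h : vis t
    · cases hf : f t
      · exact (hplus t h hf).1 ▸ Nat.le_succ _
      · exact (hminus t h hf).1.ge
    · exact (hstay t h).1.ge
  have hktop : Tendsto k atTop atTop := by
    refine tendsto_atTop_atTop_of_monotone hmono fun b => ?_
    induction b with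
    | zero => exact ⟨0, Nat.zero_le _⟩
    | succ b ih =>
      obtain ⟨t, ht⟩ := ih
      obtain ⟨r, hr, hvr, hfr⟩ := frequently_atTop.1 hfreq t
      exact ⟨r + 1, by rw [(hplus r hvr hfr).1]; exact Nat.succ_le_succ (ht.trans (hmono hr))⟩
  -- Each first measurement raises the counter by one, so summing over stages lists every step size
  -- once, starting with `α 1`.
  have hpart : ∀ T, ∑ t ∈ Finset.range T, (if vis t ∧ f t = false then α (k t + 1) else 0) =
      ∑ m ∈ Finset.range (k T), α (m + 1) := fun T => by
    induction T with
    | zero => simp [hk0]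
    | succ T ih =>
      rw [Finset.sum_range_succ, ih]
      by_cases h : vis T
      · cases hf : f T
        · rw [if_pos ⟨h, rfl⟩, (hplus T h hf).1, Finset.sum_range_succ]
        · rw [if_neg (by simp), (hminus T h hf).1, add_zero]
      · rw [if_neg (fun h' => h h'.1), (hstay T h).1, add_zero]
  have hns : ¬Summable fun t => if vis t ∧ f t = false then α (k t + 1) else 0 := fun hs => by
    have h1 := hs.hasSum.tendsto_sum_nat
    simp only [hpart] at h1
    exact not_tendsto_nhds_of_tendsto_atTop (hαsum.comp hktop) _ h1
  have hRk := hR.comp hktop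
  have hdiff : Tendsto (fun t => Φ t - R (k t)) atTop (𝓝 c) := by simpa using hΦc.sub hRk
  -- With a positive limit, `v` would eventually exceed `c / 2` whenever the flag is down, and
  -- summability of `α * v` would make the step sizes summable.
  have hc0 : c = 0 := by
    by_contra hne
    have hcpos : 0 < c := lt_of_le_of_ne (ge_of_tendsto' hΦc hΦ0) (Ne.symm hne)
    refine hns ?_
    obtain ⟨N, hN⟩ := eventually_atTop.1 (hdiff.eventually (lt_mem_nhds (half_lt_self hcpos)))
    rw [← summable_nat_add_iff N] at hsum ⊢
    refine Summable.of_nonneg_of_le (fun t => ?_) (fun t => ?_) (hsum.mul_left (2 / c))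
    · split_ifs
      exacts [hα _, le_rfl]
    · split_ifs with h
      · have h1 := hN (t + N) (Nat.le_add_left _ _)
        rw [hΦ _ h.2, add_sub_cancel_right] at h1
        have h2 : 1 ≤ 2 / c * v (t + N) := by
          rw [div_mul_eq_mul_div, le_div_iff₀ hcpos]
          linarith
        calc α (k (t + N) + 1) = α (k (t + N) + 1) * 1 := (mul_one _).symm
          _ ≤ α (k (t + N) + 1) * (2 / c * v (t + N)) := mul_le_mul_of_nonneg_left h2 (hα _)
          _ = _ := by ring
      · simp
  subst hc0
  refine ⟨hktop, ?_⟩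
  rw [tendsto_order]
  refine ⟨fun b hb => Eventually.of_forall fun t => hb.trans_le (hv t), fun ε hε => ?_⟩
  obtain ⟨N, hN⟩ := eventually_atTop.1 (hdiff.eventually (gt_mem_nhds hε))
  have hNf : ∀ t ≥ N, f t = false → v t < ε := fun t ht hf => by
    have h1 := hN t ht
    rwa [hΦ _ hf, add_sub_cancel_right] at h1
  -- The induction must start with the flag down: while the flag is up, `Φ` does not control `v`
  -- directly, but `v` keeps its value from the beginning of the pair.
  obtain ⟨T, hT, -, hfT⟩ := frequently_atTop.1 hfreq N
  refine eventually_atTop.2 ⟨T, fun t ht => ?_⟩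
  induction t, ht using Nat.le_induction with
  | base => exact hNf T hT hfT
  | succ t ht ih =>
    by_cases h : vis t
    · cases hf : f t
      · rw [(hplus t h hf).2.2]; exact ih
      · exact hNf (t + 1) (by omega) (hminus t h hf).2
    · rw [(hstay t h).2.2]; exact ih

end Path

/-! ### Almost sure convergence of supermartingales, in integrated form. -/

section Supermartingale

/-- Convergence of a nonnegative almost supermartingale with a nonnegative decrease. -/
theorem ae_tendsto_of_setLIntegral_succ_le {Ω : Type*} [mΩ : MeasurableSpace Ω] {μ : Measure Ω}
    [IsFiniteMeasure μ] {ℱ : Filtration ℕ mΩ} {Φ δ : ℕ → Ω → ENNReal}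
    (hΦ : ∀ t, Measurable[ℱ t] (Φ t)) (hδ : ∀ t, Measurable (δ t)) (h0 : ∫⁻ ω, Φ 0 ω ∂μ ≠ ⊤)
    (hstep : ∀ t A, MeasurableSet[ℱ t] A →
      ∫⁻ ω in A, Φ (t + 1) ω ∂μ + ∫⁻ ω in A, δ t ω ∂μ ≤ ∫⁻ ω in A, Φ t ω ∂μ) :
    ∀ᵐ ω ∂μ, (∃ c : ℝ, Tendsto (fun t => (Φ t ω).toReal) atTop (𝓝 c)) ∧
      ∑' t, δ t ω ≠ ⊤ := by
  have hΦm : ∀ t, Measurable (Φ t) := fun t => (hΦ t).mono (ℱ.le t) le_rfl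
  have hstep' : ∀ t, ∫⁻ ω, Φ (t + 1) ω ∂μ + ∫⁻ ω, δ t ω ∂μ ≤ ∫⁻ ω, Φ t ω ∂μ := fun t => by
    simpa only [Measure.restrict_univ] using hstep t Set.univ MeasurableSet.univ
  -- Telescoping yields both the `L¹` bound needed for martingale convergence and the integrability
  -- of the total decrease.
  have hle0 : ∀ t, ∫⁻ ω, Φ t ω ∂μ + ∑ r ∈ Finset.range t, ∫⁻ ω, δ r ω ∂μ ≤ ∫⁻ ω, Φ 0 ω ∂μ :=
    fun t => by
    induction t with
    | zero => simp
    | succ t ih =>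
      rw [Finset.sum_range_succ, add_comm (∑ _ ∈ _, _), ← add_assoc]
      exact (add_le_add (hstep' t) le_rfl).trans ih
  have hfin : ∀ t, ∫⁻ ω, Φ t ω ∂μ ≠ ⊤ := fun t =>
    ne_top_of_le_ne_top h0 (le_self_add.trans (hle0 t))
  have hint : ∀ t, Integrable (fun ω => (Φ t ω).toReal) μ := fun t =>
    integrable_toReal_of_lintegral_ne_top (hΦm t).aemeasurable (hfin t)
  have hset : ∀ t A, ∫ ω in A, (Φ t ω).toReal ∂μ = (∫⁻ ω in A, Φ t ω ∂μ).toReal := fun t A =>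
    integral_toReal (hΦm t).aemeasurable (ae_restrict_of_ae (ae_lt_top (hΦm t) (hfin t)))
  have hsetfin : ∀ t A, ∫⁻ ω in A, Φ t ω ∂μ ≠ ⊤ := fun t A =>
    ne_top_of_le_ne_top (hfin t) (setLIntegral_le_lintegral _ _)
  have hsup : Supermartingale (fun t ω => (Φ t ω).toReal) ℱ μ :=
    supermartingale_of_setIntegral_succ_le
      (fun t => (hΦ t).ennreal_toReal.stronglyMeasurable) hint fun t A hA => by
        rw [hset, hset]
        exact ENNReal.toReal_mono (hsetfin t A) (le_self_add.trans (hstep t A hA))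
  have hbdd : ∀ t, eLpNorm ((-fun t ω => (Φ t ω).toReal) t) 1 μ ≤
      ((∫⁻ ω, Φ 0 ω ∂μ).toNNReal : ENNReal) := fun t => by
    rw [Pi.neg_apply, eLpNorm_neg, eLpNorm_one_eq_lintegral_enorm, ENNReal.coe_toNNReal h0]
    refine (lintegral_mono fun ω => ?_).trans (le_self_add.trans (hle0 t))
    rw [Real.enorm_eq_ofReal ENNReal.toReal_nonneg]
    exact ENNReal.ofReal_toReal_le
  have hsumδ : ∫⁻ ω, ∑' t, δ t ω ∂μ ≠ ⊤ := by
    rw [lintegral_tsum fun t => (hδ t).aemeasurable]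
    refine ne_top_of_le_ne_top h0 (ENNReal.tsum_le_of_sum_range_le fun t => ?_)
    exact le_add_self.trans (hle0 t)
  filter_upwards [hsup.neg.exists_ae_tendsto_of_bdd hbdd,
    ae_lt_top (Measurable.tsum hδ) hsumδ] with ω h1 h2
  obtain ⟨c, hc⟩ := h1
  refine ⟨⟨-c, ?_⟩, h2.ne⟩
  simpa using hc.neg

end Supermartingale

/-! ### The Lyapunov function of one state and its mean decrease. -/

section Lyapunov

variable {K n : ℕ}

/-- The tail sums of `C * (a / c) ^ 2`. -/
noncomputable def Params.tail (p : Params K n) (C : ℝ) (i : Fin K) (k : ℕ) : ENNReal :=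
  ∑' r, ENNReal.ofReal (C * (p.a i (r + k + 1) / p.c i (r + k + 1)) ^ 2)

theorem Params.tail_eq_add (p : Params K n) (C : ℝ) (i : Fin K) (k : ℕ) :
    p.tail C i k = ENNReal.ofReal (C * (p.a i (k + 1) / p.c i (k + 1)) ^ 2) +
      p.tail C i (k + 1) := by
  unfold Params.tail
  rw [tsum_eq_zero_add' ENNReal.summable, zero_add]
  simp only [add_assoc, add_comm 1]

theorem Params.tail_zero_ne_top {p : Params K n} (hp : p.IsAdmissible) {C : ℝ} (hC : 0 ≤ C)
    (i : Fin K) : p.tail C i 0 ≠ ⊤ := by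
  unfold Params.tail
  rw [← ENNReal.ofReal_tsum_of_nonneg (fun r => by positivity)
    ((p.summable_sq_a_div_c hp i).mul_left C)]
  exact ENNReal.ofReal_ne_top

theorem Params.tail_ne_top {p : Params K n} (hp : p.IsAdmissible) {C : ℝ} (hC : 0 ≤ C)
    (i : Fin K) (k : ℕ) : p.tail C i k ≠ ⊤ := by
  induction k with
  | zero => exact p.tail_zero_ne_top hp hC i
  | succ k ih =>
    rw [p.tail_eq_add] at ih
    exact ne_top_of_le_ne_top ih le_add_self

theorem Params.tendsto_tail {p : Params K n} (hp : p.IsAdmissible) {C : ℝ} (hC : 0 ≤ C)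
    (i : Fin K) : Tendsto (fun k => (p.tail C i k).toReal) atTop (𝓝 0) := by
  have h := ENNReal.tendsto_sum_nat_add
    (fun r => ENNReal.ofReal (C * (p.a i (r + 1) / p.c i (r + 1)) ^ 2)) (p.tail_zero_ne_top hp hC i)
  exact (ENNReal.tendsto_toReal ENNReal.zero_ne_top).comp h

/-- The Lyapunov function between two pairs of measurements. -/
noncomputable def Params.lyapBase (p : Params K n) (M : Model K n) (C : ℝ) (i : Fin K)
    (l : Slot n) : ENNReal :=
  ENNReal.ofReal (‖l.1 - M.optimalInput i‖ ^ 2) + p.tail C i l.2.1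

/-- The Lyapunov function; inside a pair of measurements it is the mean value that will result
from the second measurement. -/
noncomputable def Params.lyap (p : Params K n) (M : Model K n) (ν : Measure ℝ) (C : ℝ) (i : Fin K)
    (l : Slot n) : ENNReal :=
  if l.2.2.1 = false then p.lyapBase M C i l
  else ∫⁻ u, p.lyapBase M C i (p.slotNext M i l u) ∂M.freshLaw ν i

/-- The mean decrease of the Lyapunov function. -/
noncomputable def Params.decrease (p : Params K n) (M : Model K n) (b : ℝ) (i : Fin K)
    (l : Slot n) : ENNReal :=
  if l.2.2.1 = false then
    ENNReal.ofReal (b * p.a i (l.2.1 + 1) * ‖l.1 - M.optimalInput i‖ ^ 2) else 0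

theorem Model.isProbabilityMeasure_freshLaw {M : Model K n} (hM : M.IsAdmissible) (ν : Measure ℝ)
    [IsProbabilityMeasure ν] (i : Fin K) : IsProbabilityMeasure (M.freshLaw ν i) := by
  have := M.isProbabilityMeasure_nextLaw hM i
  have := isProbabilityMeasure_vecLaw (ν := ν) (n := n)
  unfold Model.freshLaw
  infer_instance

theorem Params.measurable_lyapBase (p : Params K n) (M : Model K n) (C : ℝ) (i : Fin K) :
    Measurable (p.lyapBase M C i) := by
  have h : Measurable (p.tail C i) := measurable_of_countable _
  unfold Params.lyapBase
  fun_prop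

theorem measurableSet_flag : MeasurableSet {l : Slot n | l.2.2.1 = false} := by
  have : Measurable fun l : Slot n => l.2.2.1 := by fun_prop
  exact this (measurableSet_singleton false)

theorem Params.measurable_lyap {p : Params K n} (hp : p.IsAdmissible) {M : Model K n}
    (hM : M.IsAdmissible) (ν : Measure ℝ) [IsProbabilityMeasure ν] (C : ℝ) (i : Fin K) :
    Measurable (p.lyap M ν C i) := by
  have := M.isProbabilityMeasure_freshLaw hM ν i
  exact Measurable.ite measurableSet_flag (p.measurable_lyapBase M C i)
    (Measurable.lintegral_prod_right'
      ((p.measurable_lyapBase M C i).comp (p.measurable_slotNext hp M i)))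

theorem Params.measurable_decrease (p : Params K n) (M : Model K n) (b : ℝ) (i : Fin K) :
    Measurable (p.decrease M b i) := by
  have h : Measurable fun k => p.a i (k + 1) := measurable_of_countable _
  exact Measurable.ite measurableSet_flag (by fun_prop) measurable_const

/-- The whole decrease is booked at the first measurement, where the mean over both measurements is
compared with the present value by `lintegral_step_le`; the second measurement preserves the mean by
definition of `lyap`. -/
theorem Params.exists_lyap_step {p : Params K n} (hp : p.IsAdmissible) {M : Model K n}
    (hM : M.IsAdmissible) {ν : Measure ℝ} {ξ₁ ξ₂ : ℝ} (hν : IsPerturbationLaw ν ξ₁ ξ₂) (i : Fin K)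
    (ho : M.optimalInput i ∈ p.feasible) :
    ∃ C b : ℝ, 0 ≤ C ∧ 0 < b ∧ ∀ l : Slot n, l.1 ∈ p.feasible →
      ∫⁻ u, p.lyap M ν C i (p.slotNext M i l u) ∂M.freshLaw ν i + p.decrease M b i l ≤
        p.lyap M ν C i l := by
  have := hν.isProb
  have := M.isProbabilityMeasure_freshLaw hM ν i
  have := M.isProbabilityMeasure_nextLaw hM i
  have := isProbabilityMeasure_vecLaw (ν := ν) (n := n)
  obtain ⟨l₀, hl₀, hcoer⟩ := M.exists_quad_coercive hM i
  obtain ⟨r, hr⟩ := hp.compact.isBounded.exists_norm_le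
  -- This radius contains all inputs: feasible estimate plus the largest gain times the bound on a
  -- perturbation.
  obtain ⟨C, hC0, hC⟩ := M.exists_integral_sq_cost_le hM (r + p.γ' i * Real.sqrt (n * ξ₁ ^ 2))
  refine ⟨4 * C * (n * max ξ₂ 0), 8 * l₀, by positivity, by positivity, ?_⟩
  rintro ⟨x, k, f, d', e'⟩ hx
  cases f
  · set a := p.a i (k + 1)
    set c := p.c i (k + 1)
    have hmeas : Measurable fun q : Vec n × (Fin K × Vec n) × (Fin K × Vec n) =>
        ENNReal.ofReal (‖proj p.feasible (x - (a * ((M.cost (x + c • q.1) q.2.1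
          - M.cost (x - c • q.1) q.2.2) / c)) • recip q.1) - M.optimalInput i‖ ^ 2) := by
      have h1 : Measurable fun q : Vec n × (Fin K × Vec n) × (Fin K × Vec n) =>
          M.cost (x + c • q.1) q.2.1 := M.measurable_cost.comp
        (f := fun q : Vec n × (Fin K × Vec n) × (Fin K × Vec n) => (x + c • q.1, q.2.1))
        (by fun_prop)
      have h2 : Measurable fun q : Vec n × (Fin K × Vec n) × (Fin K × Vec n) =>
          M.cost (x - c • q.1) q.2.2 := M.measurable_cost.comp
        (f := fun q : Vec n × (Fin K × Vec n) × (Fin K × Vec n) => (x - c • q.1, q.2.2))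
        (by fun_prop)
      have h3 : Measurable (proj p.feasible) :=
        (continuous_proj hp.convex hp.compact ⟨_, ho⟩).measurable
      have h4 : Measurable fun q : Vec n × (Fin K × Vec n) × (Fin K × Vec n) => recip q.1 :=
        measurable_recip.comp measurable_fst
      fun_prop
    -- The second measurement reuses the stored direction, so the perturbation drawn at its stage
    -- integrates out and only the average over `z'` remains.
    have hval : ∀ u : Vec n × Fin K × Vec n,
        p.lyap M ν (4 * C * (n * max ξ₂ 0)) i (p.slotNext M i (x, k, false, d', e') u) =
        ∫⁻ z', ENNReal.ofReal (‖proj p.feasible (x - (a * ((M.cost (x + c • u.1) u.2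
          - M.cost (x - c • u.1) z') / c)) • recip u.1) - M.optimalInput i‖ ^ 2) ∂M.nextLaw i +
          p.tail (4 * C * (n * max ξ₂ 0)) i (k + 1) := by
      intro u
      have hm' : Measurable fun z' : Fin K × Vec n =>
          ENNReal.ofReal (‖proj p.feasible (x - (a * ((M.cost (x + c • u.1) u.2
          - M.cost (x - c • u.1) z') / c)) • recip u.1) - M.optimalInput i‖ ^ 2) :=
        hmeas.comp (f := fun z' : Fin K × Vec n => (u.1, u.2, z')) (by fun_prop)
      have h := (measurePreserving_snd (μ := vecLaw ν n) (ν := M.nextLaw i)).lintegral_comp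
        (hm'.add_const (p.tail (4 * C * (n * max ξ₂ 0)) i (k + 1)))
      refine Eq.trans h ?_
      rw [lintegral_add_right _ measurable_const, lintegral_const, measure_univ, mul_one]
    have hx' : ‖x‖ + c * Real.sqrt (n * ξ₁ ^ 2) ≤ r + p.γ' i * Real.sqrt (n * ξ₁ ^ 2) := by
      have h1 : ‖x‖ ≤ r := hr x hx
      have h2 : c ≤ p.γ' i := p.c_le hp i (k + 1)
      gcongr
    have key := lintegral_step_le hM i hν hp.convex hp.compact ho hcoer (hC i) hl₀.le
      (p.a_pos hp i k) (p.c_pos hp i k) hx'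
    have hm2 : Measurable fun u : Vec n × Fin K × Vec n =>
        ∫⁻ z', ENNReal.ofReal (‖proj p.feasible (x - (a * ((M.cost (x + c • u.1) u.2
          - M.cost (x - c • u.1) z') / c)) • recip u.1) - M.optimalInput i‖ ^ 2) ∂M.nextLaw i :=
      Measurable.lintegral_prod_right' (f := fun q : (Vec n × Fin K × Vec n) × Fin K × Vec n =>
        ENNReal.ofReal (‖proj p.feasible (x - (a * ((M.cost (x + c • q.1.1) q.1.2
          - M.cost (x - c • q.1.1) q.2) / c)) • recip q.1.1) - M.optimalInput i‖ ^ 2))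
        (hmeas.comp (f := fun q : (Vec n × Fin K × Vec n) × Fin K × Vec n =>
          (q.1.1, q.1.2, q.2)) (by fun_prop))
    simp only [hval]
    rw [lintegral_add_right _ measurable_const, lintegral_const, measure_univ, mul_one,
      Model.freshLaw, lintegral_prod _ hm2.aemeasurable]
    have hl : p.lyap M ν (4 * C * (n * max ξ₂ 0)) i (x, k, false, d', e') =
        ENNReal.ofReal (‖x - M.optimalInput i‖ ^ 2) + (ENNReal.ofReal (4 * C * (n * max ξ₂ 0) *
          (a / c) ^ 2) + p.tail (4 * C * (n * max ξ₂ 0)) i (k + 1)) := by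
      rw [← p.tail_eq_add]
      rfl
    rw [hl, ← add_assoc, add_right_comm]
    exact add_le_add key le_rfl
  -- With the flag up the next slot has the flag down, so both sides unfold to the same integral.
  · have h1 : p.decrease M (8 * l₀) i (x, k, true, d', e') = 0 := rfl
    rw [h1, add_zero]
    exact le_rfl

end Lyapunov

/-! ### From the Lyapunov function to the inputs of the policy. -/

section Policy

variable {K n : ℕ} {p : Params K n} {M : Model K n}

theorem Params.slotNext_of_false (p : Params K n) (M : Model K n) {i : Fin K} {l : Slot n}
    {u : Vec n × Fin K × Vec n} (h : l.2.2.1 = false) :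
    (p.slotNext M i l u).1 = l.1 ∧ (p.slotNext M i l u).2.1 = l.2.1 + 1 ∧
      (p.slotNext M i l u).2.2.1 = true ∧ (p.slotNext M i l u).2.2.2.1 = u.1 := by
  unfold Params.slotNext
  rw [if_pos h]
  exact ⟨rfl, rfl, rfl, rfl⟩

theorem Params.slotNext_of_true {p : Params K n} (hp : p.IsAdmissible) (M : Model K n) {i : Fin K}
    {l : Slot n} {u : Vec n × Fin K × Vec n} (h : l.2.2.1 = true) :
    (p.slotNext M i l u).1 ∈ p.feasible ∧ (p.slotNext M i l u).2.1 = l.2.1 ∧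
      (p.slotNext M i l u).2.2.1 = false ∧ (p.slotNext M i l u).2.2.2.1 = l.2.2.2.1 := by
  unfold Params.slotNext
  rw [if_neg (by simp [h])]
  exact ⟨proj_mem hp.compact ⟨_, hp.init_mem i⟩ _, rfl, rfl, rfl⟩

theorem Params.est_mem (hp : p.IsAdmissible) (M : Model K n) (s : ℕ → Fin K) (w D : ℕ → Vec n)
    (i : Fin K) (t : ℕ) : ((p.run M s w D t).slot i).1 ∈ p.feasible := by
  induction t with
  | zero => exact hp.init_mem i
  | succ t ih =>
    rw [p.slot_run_succ]
    split_ifs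
    · cases hf : ((p.run M s w D t).slot i).2.2.1
      · rw [(p.slotNext_of_false M hf).1]; exact ih
      · exact (p.slotNext_of_true hp M hf).1
    · exact ih

theorem Params.norm_pert_le (hp : p.IsAdmissible) (M : Model K n) (s : ℕ → Fin K)
    (w : ℕ → Vec n) {D : ℕ → Vec n} {ρ : ℝ} (hD : ∀ t, ‖D t‖ ≤ ρ) (i : Fin K) (t : ℕ) :
    ‖((p.run M s w D t).slot i).2.2.2.1‖ ≤ ρ := by
  induction t with
  | zero =>
    have h : ((p.run M s w D 0).slot i).2.2.2.1 = 0 := rfl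
    rw [h, norm_zero]
    exact (norm_nonneg _).trans (hD 0)
  | succ t ih =>
    rw [p.slot_run_succ]
    split_ifs
    · cases hf : ((p.run M s w D t).slot i).2.2.1
      · rw [(p.slotNext_of_false M hf).2.2.2]; exact hD t
      · rw [(p.slotNext_of_true hp M hf).2.2.2]; exact ih
    · exact ih

/-- Adding both gains gives one bound for the two kinds of measurement, whose counters are read with
a shift of one. -/
theorem Params.norm_slotInput_sub_le (hp : p.IsAdmissible) (i : Fin K) {l : Slot n} {d : Vec n}
    {ρ : ℝ} (hl : ‖l.2.2.2.1‖ ≤ ρ) (hd : ‖d‖ ≤ ρ) (o : Vec n) :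
    ‖p.slotInput i l d - o‖ ≤ ‖l.1 - o‖ + (p.c i l.2.1 + p.c i (l.2.1 + 1)) * ρ := by
  have h1 := p.c_nonneg hp i l.2.1
  have h2 := p.c_nonneg hp i (l.2.1 + 1)
  have hρ : 0 ≤ ρ := (norm_nonneg _).trans hd
  unfold Params.slotInput
  split_ifs
  · rw [add_sub_right_comm]
    refine (norm_add_le _ _).trans ?_
    rw [norm_smul, Real.norm_of_nonneg h2]
    have := mul_le_mul_of_nonneg_left hd h2
    nlinarith
  · rw [sub_right_comm]
    refine (norm_sub_le _ _).trans ?_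
    rw [norm_smul, Real.norm_of_nonneg h1]
    have := mul_le_mul_of_nonneg_left hl h1
    nlinarith

/-- On a path along which the Lyapunov function converges and decreases summably, the inputs after
the state `i` converge to the optimal input. -/
theorem Params.tendsto_input_of_lyap (hp : p.IsAdmissible) {s : ℕ → Fin K} {w D : ℕ → Vec n}
    {ν : Measure ℝ} {C b c ρ : ℝ} (hC : 0 ≤ C) (hb : 0 < b) (hD : ∀ t, ‖D t‖ ≤ ρ) (i : Fin K)
    (hΦ : Tendsto (fun t => (p.lyap M ν C i ((p.run M s w D t).slot i)).toReal) atTop (𝓝 c))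
    (hδ : ∑' t, (if s t = i then p.decrease M b i ((p.run M s w D t).slot i) else 0) ≠ ⊤) :
    Tendsto (fun t => if s t = i then
      ‖p.slotInput i ((p.run M s w D t).slot i) (D t) - M.optimalInput i‖ ^ 2 else 0)
      atTop (𝓝 0) := by
  -- If `i` is visited finitely often, the sequence is eventually zero.
  by_cases hvis : ∃ᶠ t in atTop, s t = i
  swap
  · refine (tendsto_congr' ?_).2 tendsto_const_nhds
    filter_upwards [not_frequently.1 hvis] with t ht
    rw [if_neg ht]
  set X : ℕ → Slot n := fun t => (p.run M s w D t).slot i with hX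
  have hstay : ∀ t, s t ≠ i → X (t + 1) = X t := fun t ht => by
    rw [hX]
    dsimp only
    rw [p.slot_run_succ, if_neg ht]
  have hmove : ∀ t, s t = i → X (t + 1) = p.slotNext M i (X t) (D t, s (t + 1), w t) :=
    fun t ht => by
    rw [hX]
    dsimp only
    rw [p.slot_run_succ, if_pos ht]
  obtain ⟨hk, hv⟩ := tendsto_of_lyapunov (vis := fun t => s t = i) (k := fun t => (X t).2.1)
    (f := fun t => (X t).2.2.1) (v := fun t => ‖(X t).1 - M.optimalInput i‖ ^ 2)
    (Φ := fun t => (p.lyap M ν C i (X t)).toReal) (α := fun m => b * p.a i m)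
    (R := fun k => (p.tail C i k).toReal) (c := c) rfl
    (fun t ht => by simp only [hstay t ht, and_self])
    (fun t ht hf => by
      have h := p.slotNext_of_false M (i := i) (u := (D t, s (t + 1), w t)) hf
      simp only [hmove t ht, h.1, h.2.1, h.2.2.1, and_self])
    (fun t ht hf => by
      have h := p.slotNext_of_true hp M (i := i) (u := (D t, s (t + 1), w t)) hf
      simp only [hmove t ht, h.2.1, h.2.2.1, and_self])
    hvis (fun t => sq_nonneg _)
    (fun m => mul_nonneg hb.le (by have := hp.γ_pos i; unfold Params.a; positivity))
    (by simpa only [← Finset.mul_sum] using (p.tendsto_sum_a hp i).const_mul_atTop hb)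
    (p.tendsto_tail hp hC i) (fun t => ENNReal.toReal_nonneg)
    (fun t hf => by
      rw [Params.lyap, if_pos hf, Params.lyapBase,
        ENNReal.toReal_add ENNReal.ofReal_ne_top (p.tail_ne_top hp hC i _),
        ENNReal.toReal_ofReal (sq_nonneg _)])
    hΦ
    (by
      have h := ENNReal.summable_toReal hδ
      refine h.congr fun t => ?_
      by_cases ht : s t = i
      · by_cases hf : (X t).2.2.1 = false
        · rw [if_pos ht, if_pos ⟨ht, hf⟩, Params.decrease, if_pos hf, ENNReal.toReal_ofReal]
          have := p.a_pos hp i (X t).2.1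
          positivity
        · rw [if_pos ht, if_neg (fun h => hf h.2), Params.decrease, if_neg hf,
            ENNReal.toReal_zero]
      · rw [if_neg ht, if_neg (fun h => ht h.1), ENNReal.toReal_zero])
  have hv' : Tendsto (fun t => ‖(X t).1 - M.optimalInput i‖) atTop (𝓝 0) := by
    have := (Real.continuous_sqrt.tendsto 0).comp hv
    simpa [Function.comp_def, Real.sqrt_sq] using this
  have hc1 := (p.tendsto_c i).comp hk
  have hc2 := (p.tendsto_c i).comp ((tendsto_add_atTop_nat 1).comp hk)
  have hlim : Tendsto (fun t => (‖(X t).1 - M.optimalInput i‖ +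
      (p.c i (X t).2.1 + p.c i ((X t).2.1 + 1)) * ρ) ^ 2) atTop (𝓝 0) := by
    simpa using (hv'.add ((hc1.add hc2).mul_const ρ)).pow 2
  refine squeeze_zero (fun t => ?_) (fun t => ?_) hlim
  · split_ifs <;> positivity
  · split_ifs
    · exact pow_le_pow_left₀ (norm_nonneg _)
        (p.norm_slotInput_sub_le hp i (p.norm_pert_le hp M s w hD i t) (hD t) _) 2
    · exact sq_nonneg _

variable {Ω : Type*}

/-- The slot of the state `i` after `t` stages, as a random variable. -/
noncomputable def Params.slotAt (p : Params K n) (M : Model K n) (s : ℕ → Ω → Fin K)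
    (w D : ℕ → Ω → Vec n) (i : Fin K) (t : ℕ) (ω : Ω) : Slot n :=
  (p.run M (fun r => s r ω) (fun r => w r ω) (fun r => D r ω) t).slot i

theorem Params.slotAt_succ (p : Params K n) (M : Model K n) (s : ℕ → Ω → Fin K)
    (w D : ℕ → Ω → Vec n) (i : Fin K) (t : ℕ) (ω : Ω) :
    p.slotAt M s w D i (t + 1) ω = if s t ω = i then
      p.slotNext M i (p.slotAt M s w D i t ω) (fresh s w D t ω) else p.slotAt M s w D i t ω :=
  p.slot_run_succ M _ _ _ i t

variable [mΩ : MeasurableSpace Ω] {μ : Measure Ω} {s : ℕ → Ω → Fin K} {w D : ℕ → Ω → Vec n}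
  {ν : Measure ℝ}

theorem Params.measurable_slotAt (hp : p.IsAdmissible) (M : Model K n)
    (h : M.IsRealizedBy μ s w) (hD : IsPerturbation μ ν s w D) (i : Fin K) (t : ℕ) :
    Measurable[historyFiltration h hD t] (p.slotAt M s w D i t) := by
  induction t with
  | zero =>
    have : p.slotAt M s w D i 0 = fun _ => p.start.slot i := rfl
    rw [this]
    exact measurable_const
  | succ t ih =>
    have hle := (historyFiltration h hD).mono (Nat.le_succ t)
    have ih' := ih.mono hle le_rfl
    have hs : Measurable[historyFiltration h hD (t + 1)] (s t) :=
      (measurable_state_history h hD t).mono hle le_rfl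
    have hf := measurable_fresh_history h hD t
    have : p.slotAt M s w D i (t + 1) = fun ω => if s t ω = i then
      p.slotNext M i (p.slotAt M s w D i t ω) (fresh s w D t ω) else p.slotAt M s w D i t ω :=
      funext fun ω => p.slotAt_succ M s w D i t ω
    rw [this]
    exact Measurable.ite (hs (measurableSet_singleton i))
      ((p.measurable_slotNext hp M i).comp (ih'.prodMk hf)) ih'

variable [IsProbabilityMeasure μ]

/-- Off the event that `i` is observed the slot stands still; on it `setLIntegral_fresh` turns
`exists_lyap_step` into the integrated supermartingale inequality. -/
theorem Params.ae_tendsto_input_of_state (hp : p.IsAdmissible) (hM : M.IsAdmissible)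
    {ξ₁ ξ₂ : ℝ} (hν : IsPerturbationLaw ν ξ₁ ξ₂) (h : M.IsRealizedBy μ s w)
    (hD : IsPerturbation μ ν s w D) (i : Fin K) (ho : M.optimalInput i ∈ p.feasible) {ρ : ℝ}
    (hρ : ∀ᵐ ω ∂μ, ∀ t, ‖D t ω‖ ≤ ρ) :
    ∀ᵐ ω ∂μ, Tendsto (fun t => if s t ω = i then
      ‖p.slotInput i (p.slotAt M s w D i t ω) (D t ω) - M.optimalInput i‖ ^ 2 else 0)
      atTop (𝓝 0) := by
  have := hν.isProb
  obtain ⟨C, b, hC, hb, hstep⟩ := p.exists_lyap_step hp hM hν i ho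
  have hX := fun t => p.measurable_slotAt hp M h hD i t
  have hX' := fun t => (hX t).mono ((historyFiltration h hD).le t) le_rfl
  have hi : ∀ t, MeasurableSet {ω | s t ω = i} := fun t =>
    h.measurable_state t (measurableSet_singleton i)
  have hly := p.measurable_lyap hp hM ν C i
  have key := ae_tendsto_of_setLIntegral_succ_le (μ := μ) (ℱ := historyFiltration h hD)
    (Φ := fun t ω => p.lyap M ν C i (p.slotAt M s w D i t ω))
    (δ := fun t ω => if s t ω = i then p.decrease M b i (p.slotAt M s w D i t ω) else 0)
    (fun t => hly.comp (hX t))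
    (fun t => Measurable.ite (hi t) ((p.measurable_decrease M b i).comp (hX' t)) measurable_const)
    (by
      have : ∀ ω, p.lyap M ν C i (p.slotAt M s w D i 0 ω) =
        p.lyapBase M C i (p.start.slot i) := fun ω => rfl
      simp only [this, lintegral_const, measure_univ, mul_one]
      exact ENNReal.add_ne_top.2 ⟨ENNReal.ofReal_ne_top, p.tail_ne_top hp hC i _⟩)
    (by
      intro t A hA
      rw [← lintegral_inter_add_sdiff _ A (hi t), ← lintegral_inter_add_sdiff
        (fun ω => if s t ω = i then p.decrease M b i (p.slotAt M s w D i t ω) else 0) A (hi t),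
        ← lintegral_inter_add_sdiff (fun ω => p.lyap M ν C i (p.slotAt M s w D i t ω)) A (hi t)]
      have hAm : MeasurableSet A := (historyFiltration h hD).le t A hA
      have hin : MeasurableSet (A ∩ {ω | s t ω = i}) := hAm.inter (hi t)
      have hout : MeasurableSet (A \ {ω | s t ω = i}) := hAm.diff (hi t)
      have e1 : ∫⁻ ω in A \ {ω | s t ω = i}, p.lyap M ν C i (p.slotAt M s w D i (t + 1) ω) ∂μ =
          ∫⁻ ω in A \ {ω | s t ω = i}, p.lyap M ν C i (p.slotAt M s w D i t ω) ∂μ :=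
        setLIntegral_congr_fun hout fun ω hω => by
          have hs : ¬s t ω = i := hω.2
          simp only [p.slotAt_succ, if_neg hs]
      have e2 : ∫⁻ ω in A \ {ω | s t ω = i},
          (if s t ω = i then p.decrease M b i (p.slotAt M s w D i t ω) else 0) ∂μ = 0 := by
        refine (setLIntegral_congr_fun (g := fun _ => 0) hout fun ω hω => if_neg hω.2).trans ?_
        simp
      have e3 : ∫⁻ ω in A ∩ {ω | s t ω = i},
          (if s t ω = i then p.decrease M b i (p.slotAt M s w D i t ω) else 0) ∂μ =
          ∫⁻ ω in A ∩ {ω | s t ω = i}, p.decrease M b i (p.slotAt M s w D i t ω) ∂μ :=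
        setLIntegral_congr_fun hin fun ω hω => if_pos hω.2
      have e4 : ∫⁻ ω in A ∩ {ω | s t ω = i}, p.lyap M ν C i (p.slotAt M s w D i (t + 1) ω) ∂μ =
          ∫⁻ ω in A ∩ {ω | s t ω = i}, ∫⁻ u, p.lyap M ν C i
            (p.slotNext M i (p.slotAt M s w D i t ω) u) ∂M.freshLaw ν i ∂μ := by
        rw [← setLIntegral_fresh hM h hD t i hA (hX t)
          (φ := fun q => p.lyap M ν C i (p.slotNext M i q.1 q.2))
          (hly.comp (p.measurable_slotNext hp M i))]
        exact setLIntegral_congr_fun hin fun ω hω => by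
          have hs : s t ω = i := hω.2
          simp only [p.slotAt_succ, if_pos hs]
      rw [e1, e2, e3, e4, add_zero, add_right_comm]
      refine add_le_add ?_ le_rfl
      have hdm : Measurable fun ω => p.decrease M b i (p.slotAt M s w D i t ω) :=
        (p.measurable_decrease M b i).comp (hX' t)
      rw [← lintegral_add_right _ hdm]
      exact lintegral_mono fun ω => hstep _ (p.est_mem hp M _ _ _ i t))
  filter_upwards [key, hρ] with ω hω hρω
  obtain ⟨⟨c, hc⟩, hδ⟩ := hω
  exact p.tendsto_input_of_lyap hp hC hb hρω i hc hδ

end Policy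

end MarkovJump

/-! ### Almost sure and mean square convergence. -/

theorem mainTheorem7 {K n : ℕ} (M : MarkovJump.Model K n) (hM : M.IsAdmissible)
    (p : MarkovJump.Params K n) (hp : p.IsAdmissible)
    (hopt : ∀ i, M.optimalInput i ∈ p.feasible)
    (ν : Measure ℝ) (ξ₁ ξ₂ : ℝ) (hν : MarkovJump.IsPerturbationLaw ν ξ₁ ξ₂)
    {Ω : Type*} [MeasurableSpace Ω] (μ : Measure Ω) [IsProbabilityMeasure μ]
    (s : ℕ → Ω → Fin K) (w D : ℕ → Ω → MarkovJump.Vec n)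
    (hsw : M.IsRealizedBy μ s w) (hD : MarkovJump.IsPerturbation μ ν s w D) :
    (∀ᵐ ω ∂μ, Tendsto
      (fun t => ‖p.inputAt M (fun r => s r ω) (fun r => w r ω) (fun r => D r ω) t
        - M.optimalInput (s t ω)‖ ^ 2) atTop (𝓝 0)) ∧
    (∀ t, Integrable
      (fun ω => ‖p.inputAt M (fun r => s r ω) (fun r => w r ω) (fun r => D r ω) t
        - M.optimalInput (s t ω)‖ ^ 2) μ) ∧
    Tendsto
      (fun t => ∫ ω, ‖p.inputAt M (fun r => s r ω) (fun r => w r ω) (fun r => D r ω) t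
        - M.optimalInput (s t ω)‖ ^ 2 ∂μ) atTop (𝓝 0) := by
  open MarkovJump in
  set ρ := Real.sqrt (n * ξ₁ ^ 2) with hρdef
  have hρ : ∀ᵐ ω ∂μ, ∀ t, ‖D t ω‖ ≤ ρ := by
    refine ae_all_iff.2 fun t => ?_
    have h := hν.ae_norm_le (n := n)
    rw [← hD.map_eq t] at h
    exact ae_of_ae_map (hD.measurable t).aemeasurable h
  -- Exactly one summand is active at each stage, so convergence for the finitely many states
  -- separately is enough.
  have hrepr : ∀ t ω, ‖p.inputAt M (fun r => s r ω) (fun r => w r ω) (fun r => D r ω) t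
      - M.optimalInput (s t ω)‖ ^ 2 = ∑ i, if s t ω = i then
        ‖p.slotInput i (p.slotAt M s w D i t ω) (D t ω) - M.optimalInput i‖ ^ 2 else 0 :=
    fun t ω => by
    rw [Finset.sum_ite_eq, if_pos (Finset.mem_univ _)]
    rfl
  have hlim : ∀ᵐ ω ∂μ, Tendsto
      (fun t => ‖p.inputAt M (fun r => s r ω) (fun r => w r ω) (fun r => D r ω) t
        - M.optimalInput (s t ω)‖ ^ 2) atTop (𝓝 0) := by
    have h := ae_all_iff.2 fun i =>
      p.ae_tendsto_input_of_state hp hM hν hsw hD i (hopt i) hρ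
    filter_upwards [h] with ω hω
    simp only [hrepr]
    simpa using tendsto_finsetSum Finset.univ fun i _ => hω i
  have hmeas : ∀ t, Measurable
      (fun ω => ‖p.inputAt M (fun r => s r ω) (fun r => w r ω) (fun r => D r ω) t
        - M.optimalInput (s t ω)‖ ^ 2) := fun t => by
    simp only [hrepr]
    refine Finset.measurable_sum _ fun i _ => ?_
    have hX : Measurable (p.slotAt M s w D i t) :=
      (p.measurable_slotAt hp M hsw hD i t).mono ((historyFiltration hsw hD).le t) le_rfl
    have hin : Measurable fun ω => p.slotInput i (p.slotAt M s w D i t ω) (D t ω) :=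
      (p.measurable_slotInput i).comp (hX.prodMk (hD.measurable t))
    exact Measurable.ite (hsw.measurable_state t (measurableSet_singleton i))
      ((hin.sub_const _).norm.pow_const 2) measurable_const
  obtain ⟨r, hr⟩ := hp.compact.isBounded.exists_norm_le
  set G : ℝ := ∑ i, p.γ' i
  -- The constant that dominates: estimate and optimum lie in the feasible set of radius `r`, and
  -- `G` bounds every gain.
  have hbound : ∀ t, ∀ᵐ ω ∂μ,
      ‖‖p.inputAt M (fun r => s r ω) (fun r => w r ω) (fun r => D r ω) t
        - M.optimalInput (s t ω)‖ ^ 2‖ ≤ (r + r + (G + G) * ρ) ^ 2 := fun t => by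
    filter_upwards [hρ] with ω hω
    rw [Real.norm_of_nonneg (sq_nonneg _)]
    refine pow_le_pow_left₀ (norm_nonneg _) ?_ 2
    have h1 := p.norm_slotInput_sub_le hp (s t ω)
      (p.norm_pert_le hp M (fun r => s r ω) (fun r => w r ω) hω (s t ω) t) (hω t)
      (M.optimalInput (s t ω))
    have hγ : p.γ' (s t ω) ≤ G :=
      Finset.single_le_sum (fun i _ => (hp.γ'_pos i).le) (Finset.mem_univ (s t ω))
    refine h1.trans ?_
    refine add_le_add ((norm_sub_le _ _).trans (add_le_add (hr _ (p.est_mem hp M _ _ _ _ t))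
      (hr _ (hopt _)))) ?_
    exact mul_le_mul_of_nonneg_right (add_le_add ((p.c_le hp _ _).trans hγ)
      ((p.c_le hp _ _).trans hγ)) (Real.sqrt_nonneg _)
  refine ⟨hlim, fun t => ?_, ?_⟩
  · exact Integrable.mono' (integrable_const _) (hmeas t).aestronglyMeasurable (hbound t)
  · have h := tendsto_integral_of_dominated_convergence (fun _ => (r + r + (G + G) * ρ) ^ 2)
      (fun t => (hmeas t).aestronglyMeasurable) (integrable_const _) hbound hlim
    simpa using h
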